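/- **Notation.** Let $\Omega\subset\mathbb R^3$ be open. $\mathcal D(\Omega)$ is the space of smooth functions with compact support in $\Omega$, and $\mathcal M(\Omega)$ is the class of distributions on $\Omega$ that are finite signed Radon measures. $BV(\Omega,\mathbb R^3)$ is the class of $f\in L^1(\Omega,\mathbb R^3)$ whose distributional partial derivatives all belong to $\mathcal M(\Omega)$. Put $1'=2,\ 2'=3,\ 3'=1$, $i''=(i')'$, and for $t\in\mathbb R$, $y\in\mathbb R^2$ $$\kappa_1^t(y)=(t,y_1,y_2),\quad \kappa_2^t(y)=(y_2,t,y_1),\quad \kappa_3^t(y)=(y_1,y_2,t).$$ A mollification kernel on $\mathbb R^n$ is a smooth $\rho\ge 0$ supported in the closed unit ball with $\int\rho=1$; for a map $g$ given on an open set (and extended by $0$) put $g_\varepsilon=\rho_\varepsilon*g$ with $\rho_\varepsilon(x)=\varepsilon^{-n}\rho(x/\varepsilon)$. * For a continuous map $g\colon G\to\mathbb R^2$ on an open set $G\subset\mathbb R^2$, the distributional Jacobian $\operatorname{Det}Dg$ is the limit in distributions on $G$ of $\det\nabla g_\varepsilon$ as $\varepsilon\to0+$ (for every kernel, with the same limit),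 if it exists. * For a continuous $f\in BV(\Omega,\mathbb R^3)$, the distributional adjugate of the second kind $\operatorname{Adj}Df$ is the limit in distributions on $\Omega$ of $\operatorname{adj}\nabla f_\varepsilon$ as $\varepsilon\to0+$ (for every kernel, with the same limit), where $(\nabla f)_{kl}=\partial f_k/\partial x_l$ and $A\operatorname{adj}A=I\det A$. * Let $\Omega_t=(\kappa_i^t)^{-1}(\Omega)$ and $\delta_t=\delta_t^{ij}=\operatorname{Det}\bigl(D(f_{j'}\circ\kappa_i^t),D(f_{j''}\circ\kappa_i^t)\bigr)$, a distribution on $\Omega_t$. The distributional adjugate of the first kind is $$\langle \mathrm{ADJ}_{ij}Df,\varphi\rangle=\int_{-\infty}^{\infty}\langle\delta_t^{ij},\varphi\circ\kappa_i^t\rangle\,dt,\qquad\varphi\in\mathcal D(\Omega),$$ where $\delta^{ij}_t$ is required to exist for a.e. $t$ and the integral to converge absolutely. * One writes $\mathcal{A}dj\,Df$ for $\mathrm{ADJ}\,Df$ when, for all $i,j$ and a.e. $t$, the distribution $\delta_t^{ij}$ is a finite signed Radon measure on $\Omega_t$. **Proposition 4.3.** Let $f\in BV(\Omega,\mathbb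 R^3)$ be continuous on $\Omega$. 1. For all $i,j\in\{1,2,3\}$ the distributions $\operatorname{Adj}_{ij}Df$ and $\mathrm{ADJ}_{ij}Df$ exist and $\mathrm{ADJ}_{ij}Df=\operatorname{Adj}_{ij}Df$. 2. For all $i,j\in\{1,2,3\}$: if $\operatorname{Adj}_{ij}Df\in\mathcal M(\Omega)$, then for a.e. $t\in\mathbb R$ the distribution $\delta_t^{ij}$ is a finite signed Radon measure on $\Omega_t$, and the function $t\mapsto|\delta_t^{ij}|(\Omega_t)$ is Lebesgue integrable. 3. Consequently, if $\operatorname{Adj}_{ij}Df\in\mathcal M(\Omega)$ for all $i,j$, then $\mathcal{A}dj\,Df$ is defined and $\operatorname{Adj}Df=\mathrm{ADJ}\,Df=\mathcal{A}dj\,Df$. -/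

import Mathlib

open MeasureTheory Filter Topology TopologicalSpace
open scoped Distributions ContDiff CompactConvergenceCLM

/-- The Euclidean space `ℝⁿ`. -/
abbrev Euc (n : ℕ) := EuclideanSpace ℝ (Fin n)

noncomputable section

/-! ### Measures as distributions, functions of bounded variation -/

/-- The distribution `T` on `Ω` belongs to `M(Ω)` and is represented by the finite signed
Radon measure `μ`: `⟨T, φ⟩ = ∫ φ dμ` for all test functions `φ` on `Ω`. The measure `μ` is defined
on all Borel sets of `ℝⁿ`, but only its restriction to `Ω` matters.
(A finite signed Borel measure on `ℝⁿ` is automatically Radon.) -/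
def IsRepresentedBy {n : ℕ} {Ω : Opens (Euc n)} (T : 𝓓'(Ω, ℝ)) (μ : SignedMeasure (Euc n)) :
    Prop :=
  ∀ φ : 𝓓(Ω, ℝ), T φ = ∫ᵛ x, φ x ∂•μ

/-- `T ∈ M(Ω)`: the distribution `T` is a finite signed Radon measure on `Ω`. -/
def IsFiniteRadon {n : ℕ} {Ω : Opens (Euc n)} (T : 𝓓'(Ω, ℝ)) : Prop :=
  ∃ μ : SignedMeasure (Euc n), IsRepresentedBy T μ

/-- `f ∈ BV(Ω, ℝᵐ)`: `f` is integrable on `Ω` and each distributional partial derivative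
`D_l f_k` is a finite signed Radon measure on `Ω`. -/
def MemBV {n m : ℕ} (Ω : Opens (Euc n)) (f : Euc n → Euc m) : Prop :=
  IntegrableOn f (Ω : Set (Euc n)) ∧
    ∀ (k : Fin m) (l : Fin n), ∃ μ : SignedMeasure (Euc n), ∀ φ : 𝓓(Ω, ℝ),
      ∫ x in (Ω : Set (Euc n)), f x k * fderiv ℝ φ x (EuclideanSpace.single l 1) =
        - ∫ᵛ x, φ x ∂•μ

/-! ### Mollification -/

/-- A mollification kernel on `ℝⁿ`: smooth, nonnegative, supported in the closed unit ball and
of integral one. -/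
structure IsMollifier {n : ℕ} (ρ : Euc n → ℝ) : Prop where
  contDiff : ContDiff ℝ ∞ ρ
  nonneg : ∀ x, 0 ≤ ρ x
  tsupport_subset : tsupport ρ ⊆ Metric.closedBall 0 1
  integral_eq_one : ∫ x, ρ x = 1

/-- The mollification at scale `ε` of a map `g` given on the open set `Ω`, that is
`ρ_ε ⋆ g` with `ρ_ε(x) = ε⁻ⁿ ρ(x / ε)`, where `g` is extended by zero outside `Ω`. The extension
does not affect the values at points whose distance from the complement of `Ω` exceeds `ε`. -/
def mollify {n m : ℕ} (ρ : Euc n → ℝ) (ε : ℝ) (Ω : Opens (Euc n)) (g : Euc n → Euc m) :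
    Euc n → Euc m :=
  convolution (fun x => (ε ^ n)⁻¹ * ρ (ε⁻¹ • x)) ((Ω : Set (Euc n)).indicator g)
    (ContinuousLinearMap.lsmul ℝ ℝ) volume

/-- The gradient matrix `∇u(x)`, with entry `∂u_k/∂x_l (x)` in row `k` and column `l`. -/
def gradMatrix {n m : ℕ} (u : Euc n → Euc m) (x : Euc n) : Matrix (Fin m) (Fin n) ℝ :=
  Matrix.of fun k l => fderiv ℝ u x (EuclideanSpace.single l 1) k

/-! ### Distributional Jacobian and distributional adjugate of the second kind -/

/-- `T` is the distributional Jacobian `Det Dg` of the planar map `g` on the open set `G`: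
the limit in distributions of `det ∇g_ε`, where `g_ε → g` are mollifications of `g`.
(The limit does not depend on the choice of the kernel.) -/
def IsDistJacobian (G : Opens (Euc 2)) (g : Euc 2 → Euc 2) (T : 𝓓'(G, ℝ)) : Prop :=
  ∀ ρ : Euc 2 → ℝ, IsMollifier ρ → ∀ φ : 𝓓(G, ℝ),
    Tendsto (fun ε : ℝ => ∫ x, (gradMatrix (mollify ρ ε G g) x).det * φ x)
      (𝓝[>] 0) (𝓝 (T φ))

/-- `T` is the entry `Adj_{ij} Df` of the distributional adjugate of the second kind of `f`:
the limit in distributions of `(adj ∇f_ε)_{ij}`, where `f_ε → f` are mollifications of `f`.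
Here `adj A` is the transposed cofactor matrix, `A (adj A) = (det A) I`. -/
def IsAdjSecond (Ω : Opens (Euc 3)) (f : Euc 3 → Euc 3) (i j : Fin 3) (T : 𝓓'(Ω, ℝ)) : Prop :=
  ∀ ρ : Euc 3 → ℝ, IsMollifier ρ → ∀ φ : 𝓓(Ω, ℝ),
    Tendsto (fun ε : ℝ => ∫ x, (gradMatrix (mollify ρ ε Ω f) x).adjugate i j * φ x)
      (𝓝[>] 0) (𝓝 (T φ))

/-! ### Slices and distributional adjugate of the first kind -/

/-- The parametrization `κ_i^t` of the plane `{x_i = t}`. Indices are in `Fin 3` with cyclic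
addition, so `i' = i + 1` and `i'' = i + 2`: the point `κ_i^t(y)` has `i`-th coordinate `t`,
`i'`-th coordinate `y_1` and `i''`-th coordinate `y_2`. -/
def kappa (i : Fin 3) (t : ℝ) (y : Euc 2) : Euc 3 :=
  WithLp.toLp 2 fun k => if k = i then t else if k = i + 1 then y 0 else y 1

lemma contDiff_kappa (i : Fin 3) (t : ℝ) : ContDiff ℝ ∞ (kappa i t) := by
  rw [contDiff_euclidean]
  intro k
  simp only [kappa]
  split_ifs <;> fun_prop

lemma continuous_kappa (i : Fin 3) (t : ℝ) : Continuous (kappa i t) :=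
  (contDiff_kappa i t).continuous

lemma isClosedEmbedding_kappa (i : Fin 3) (t : ℝ) : IsClosedEmbedding (kappa i t) := by
  have hc : Continuous fun x : Euc 3 => (WithLp.toLp 2 ![x (i + 1), x (i + 2)] : Euc 2) := by
    fun_prop
  have hl : Function.LeftInverse
      (fun x : Euc 3 => (WithLp.toLp 2 ![x (i + 1), x (i + 2)] : Euc 2)) (kappa i t) := by
    intro y
    ext k
    fin_cases i <;> fin_cases k <;> simp [kappa]
  exact hl.isClosedEmbedding hc (continuous_kappa i t)

/-- The slice `Ω_t = (κ_i^t)⁻¹(Ω)`. -/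
def sliceOpens (Ω : Opens (Euc 3)) (i : Fin 3) (t : ℝ) : Opens (Euc 2) :=
  Ω.comap ⟨kappa i t, continuous_kappa i t⟩

/-- The test function `φ ∘ κ_i^t` on `Ω_t`, for a test function `φ` on `Ω`. -/
def sliceTest {Ω : Opens (Euc 3)} (i : Fin 3) (t : ℝ) (φ : 𝓓(Ω, ℝ)) :
    𝓓(sliceOpens Ω i t, ℝ) where
  toFun := φ ∘ kappa i t
  contDiff' := φ.contDiff.comp (contDiff_kappa i t)
  hasCompactSupport' := φ.hasCompactSupport.comp_isClosedEmbedding (isClosedEmbedding_kappa i t)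
  tsupport_subset' :=
    (tsupport_comp_subset_preimage φ (continuous_kappa i t)).trans
      (Set.preimage_mono φ.tsupport_subset)

/-- The planar map `(f_{j'} ∘ κ_i^t, f_{j''} ∘ κ_i^t)`. -/
def sliceMap (f : Euc 3 → Euc 3) (i j : Fin 3) (t : ℝ) (y : Euc 2) : Euc 2 :=
  WithLp.toLp 2 ![f (kappa i t y) (j + 1), f (kappa i t y) (j + 2)]

/-- `S` is the distributional Jacobian `Det (D(f_{j'} ∘ κ_i^t), D(f_{j''} ∘ κ_i^t))` on `Ω_t`. -/
def IsSliceJacobian (Ω : Opens (Euc 3)) (f : Euc 3 → Euc 3) (i j : Fin 3) (t : ℝ)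
    (S : 𝓓'(sliceOpens Ω i t, ℝ)) : Prop :=
  IsDistJacobian (sliceOpens Ω i t) (sliceMap f i j t) S

/-- `T` is the entry `ADJ_{ij} Df` of the distributional adjugate of the first kind of `f`:
for almost every `t` the slice Jacobian exists, and `⟨T, φ⟩` is the integral over `t ∈ ℝ` of the
slice Jacobians applied to `φ ∘ κ_i^t`, the integral being (absolutely) convergent. -/
def IsAdjFirst (Ω : Opens (Euc 3)) (f : Euc 3 → Euc 3) (i j : Fin 3) (T : 𝓓'(Ω, ℝ)) : Prop :=
  ∃ S : ∀ t : ℝ, 𝓓'(sliceOpens Ω i t, ℝ),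
    (∀ᵐ t : ℝ, IsSliceJacobian Ω f i j t (S t)) ∧
    ∀ φ : 𝓓(Ω, ℝ), Integrable (fun t : ℝ => S t (sliceTest i t φ)) ∧
      T φ = ∫ t : ℝ, S t (sliceTest i t φ)

/-- The matrix `T` of distributions is the adjugate `adj` of `f` obtained from the first kind:
`T = ADJ Df`, where moreover, for all `i`, `j` and almost every `t`, the slice Jacobian is a signed
Radon measure. -/
def IsSliceMeasureAdj (Ω : Opens (Euc 3)) (f : Euc 3 → Euc 3)
    (T : Fin 3 → Fin 3 → 𝓓'(Ω, ℝ)) : Prop :=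
  (∀ i j, IsAdjFirst Ω f i j (T i j)) ∧
    ∀ i j, ∀ᵐ t : ℝ, ∃ S : 𝓓'(sliceOpens Ω i t, ℝ),
      IsSliceJacobian Ω f i j t S ∧ IsFiniteRadon S

end

/-!
Put `u = f_{j'}` and `v = f_{j''}`. Both kinds of adjugates rest on the identity
`∂_a u ∂_b v - ∂_b u ∂_a v = ∂_a (u ∂_b v) - ∂_b (u ∂_a v)`, valid for smooth functions, whose
right hand side makes sense as a distribution as soon as `u` is continuous and `∂_a v`, `∂_b v` are
measures. Since `u_ε → u` locally uniformly while the mollifications of `∂_a v`, `∂_b v` converge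
weakly as measures, the minors of the mollifications converge to this distribution
(`tendsto_integral_minor`). In dimension three this gives the adjugate of the second kind; in
dimension two it gives the Jacobian of almost every slice, once it is known that almost every slice
of `v` has measures as derivatives.

The latter, and the statement that the slice Jacobians are measures if the adjugate is, are two
instances of one slicing theorem (`ae_eq_integral_sliceKernel`). Let distributions `S_t` on the
planes `{x_i = t}` integrate to a measure `σ μ`, where `μ` is a finite positive measure.
Disintegrate `μ` over the `x_i`-axis into conditional probabilities `K_t` and the projection `m`.
Testing with
`a(x_i) φ(x)` shows that `S_t(φ) dt` and `(∫ φ σ dK_t) m(dt)` are the same measure on the line, so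
that `S_t(φ) = c(t) ∫ φ σ dK_t` for almost every `t`, where `c` is the density of the absolutely
continuous part of `m`. If the `S_t` are of order at most one, a countable `C¹`-dense family of test
functions makes the exceptional null set independent of `φ`. Hence `S_t = c(t) σ K_t` is a measure,
and its total variation is at most the integrable function `c`.

With `S_t = ∂_b (v ∘ κ_i^t)` this yields the slices of the measures `∂_l v`, and integrating the
slice Jacobians over `t` recovers the adjugate of the second kind, by Fubini's theorem for the
disintegration (`exists_adjugate`). With `S_t` the slice Jacobians it yields `exists_slice_measure`.
-/

noncomputable section

/-! ### Mollification of scalar functions -/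

/-- The rescaled kernel `ρ_ε(x) = ε⁻ⁿ ρ(x / ε)`. -/
def scaledKernel {n : ℕ} (ρ : Euc n → ℝ) (ε : ℝ) (x : Euc n) : ℝ := (ε ^ n)⁻¹ * ρ (ε⁻¹ • x)

/-- The partial derivative `∂_a u` of a scalar function. -/
def partialDeriv {n : ℕ} (a : Fin n) (u : Euc n → ℝ) (x : Euc n) : ℝ :=
  fderiv ℝ u x (EuclideanSpace.single a 1)

/-- The scalar mollification `ρ_ε ⋆ u`. -/
def smoothen {n : ℕ} (ρ : Euc n → ℝ) (ε : ℝ) (u : Euc n → ℝ) : Euc n → ℝ :=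
  convolution (scaledKernel ρ ε) u (ContinuousLinearMap.lsmul ℝ ℝ) volume

namespace IsMollifier

variable {n : ℕ} {ρ : Euc n → ℝ}

lemma reflect (hρ : IsMollifier ρ) : IsMollifier fun x => ρ (-x) where
  contDiff := hρ.contDiff.comp contDiff_neg
  nonneg x := hρ.nonneg _
  tsupport_subset := by
    refine (tsupport_comp_subset_preimage ρ continuous_neg).trans fun x hx => ?_
    simpa using hρ.tsupport_subset hx
  integral_eq_one := by rw [integral_neg_eq_self ρ]; exact hρ.integral_eq_one

lemma contDiff_scaled (hρ : IsMollifier ρ) (ε : ℝ) : ContDiff ℝ ∞ (scaledKernel ρ ε) :=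
  contDiff_const.mul (hρ.contDiff.comp (contDiff_const_smul _))

lemma continuous_scaled (hρ : IsMollifier ρ) (ε : ℝ) : Continuous (scaledKernel ρ ε) :=
  (hρ.contDiff_scaled ε).continuous

lemma scaled_nonneg (hρ : IsMollifier ρ) {ε : ℝ} (hε : 0 < ε) (x : Euc n) :
    0 ≤ scaledKernel ρ ε x := mul_nonneg (by positivity) (hρ.nonneg _)

lemma integral_scaled (hρ : IsMollifier ρ) {ε : ℝ} (hε : 0 < ε) :
    ∫ x, scaledKernel ρ ε x = 1 := by
  simp only [scaledKernel]
  rw [integral_const_mul, Measure.integral_comp_inv_smul, hρ.integral_eq_one]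
  simp [abs_of_pos hε, hε.ne']

lemma tsupport_scaled (hρ : IsMollifier ρ) {ε : ℝ} (hε : 0 < ε) :
    tsupport (scaledKernel ρ ε) ⊆ Metric.closedBall 0 ε := by
  refine closure_minimal (fun x hx => ?_) Metric.isClosed_closedBall
  have hx' : ρ (ε⁻¹ • x) ≠ 0 := fun h => hx (by simp [scaledKernel, h])
  have := hρ.tsupport_subset (subset_tsupport _ hx')
  simp only [mem_closedBall_zero_iff, norm_smul, norm_inv, Real.norm_eq_abs, abs_of_pos hε]
    at this ⊢
  rwa [inv_mul_le_iff₀ hε, mul_one] at this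

lemma hasCompactSupport_scaled (hρ : IsMollifier ρ) {ε : ℝ} (hε : 0 < ε) :
    HasCompactSupport (scaledKernel ρ ε) :=
  (isCompact_closedBall (0 : Euc n) ε).of_isClosed_subset (isClosed_tsupport _)
    (hρ.tsupport_scaled hε)

lemma tendsto_support_scaled (hρ : IsMollifier ρ) :
    Tendsto (fun ε => Function.support (scaledKernel ρ ε)) (𝓝[>] 0) (𝓝 0).smallSets := by
  rw [tendsto_smallSets_iff]
  intro t ht
  obtain ⟨δ, hδ, hb⟩ := Metric.mem_nhds_iff.1 ht
  filter_upwards [Ioo_mem_nhdsGT hδ] with ε hε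
  refine (subset_tsupport _).trans ((hρ.tsupport_scaled hε.1).trans ?_)
  exact (Metric.closedBall_subset_ball hε.2).trans hb

/-- If `g_ε(x) → z` as `(ε, x) → (0, x₀)`, then also `(ρ_ε ⋆ g_ε)(x) → z`. -/
lemma tendsto_smoothen (hρ : IsMollifier ρ) {g : ℝ → Euc n → ℝ} {x₀ : Euc n} {z : ℝ}
    (hm : ∀ᶠ ε in 𝓝[>] (0 : ℝ), AEStronglyMeasurable (g ε))
    (hg : Tendsto (Function.uncurry g) (𝓝[>] 0 ×ˢ 𝓝 x₀) (𝓝 z)) :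
    Tendsto (Function.uncurry fun ε => smoothen ρ ε (g ε)) (𝓝[>] 0 ×ˢ 𝓝 x₀) (𝓝 z) := by
  have hpos : ∀ᶠ p : ℝ × Euc n in 𝓝[>] 0 ×ˢ 𝓝 x₀, 0 < p.1 :=
    tendsto_fst.eventually (eventually_mem_nhdsWithin (a := (0 : ℝ)) (s := Set.Ioi 0))
  refine convolution_tendsto_right (φ := fun p : ℝ × Euc n => scaledKernel ρ p.1)
    (g := fun p : ℝ × Euc n => g p.1) (k := Prod.snd) ?_ ?_ ?_ ?_ ?_ tendsto_snd
  · filter_upwards [hpos] with p hp using hρ.scaled_nonneg hp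
  · filter_upwards [hpos] with p hp using hρ.integral_scaled hp
  · exact hρ.tendsto_support_scaled.comp tendsto_fst
  · exact tendsto_fst.eventually hm
  · exact hg.comp ((tendsto_fst.comp tendsto_fst).prodMk tendsto_snd)

lemma contDiff_smoothen (hρ : IsMollifier ρ) {ε : ℝ} (hε : 0 < ε) {u : Euc n → ℝ}
    (hu : LocallyIntegrable u) : ContDiff ℝ ∞ (smoothen ρ ε u) :=
  (hρ.hasCompactSupport_scaled hε).contDiff_convolution_left _ (hρ.contDiff_scaled ε) hu

/-- Mollification does not increase bounds. -/
lemma abs_smoothen_le (hρ : IsMollifier ρ) {ε : ℝ} (hε : 0 < ε) {u : Euc n → ℝ} {C : ℝ}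
    {x : Euc n} (hb : ∀ y ∈ Metric.closedBall x ε, |u y| ≤ C) : |smoothen ρ ε u x| ≤ C := by
  have hk := hρ.integral_scaled hε
  have hki : Integrable (scaledKernel ρ ε) := integrable_of_integral_eq_one hk
  calc |smoothen ρ ε u x| ≤ ∫ t, scaledKernel ρ ε t * C := by
        rw [smoothen, convolution_def, ← Real.norm_eq_abs]
        refine norm_integral_le_of_norm_le (hki.mul_const C) (ae_of_all _ fun t => ?_)
        simp only [ContinuousLinearMap.lsmul_apply, norm_smul, Real.norm_eq_abs,
          abs_of_nonneg (hρ.scaled_nonneg hε t)]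
        by_cases ht : scaledKernel ρ ε t = 0
        · simp [ht]
        · refine mul_le_mul_of_nonneg_left (hb _ ?_) (hρ.scaled_nonneg hε t)
          have := hρ.tsupport_scaled hε (subset_tsupport _ ht)
          simpa [dist_eq_norm] using this
    _ = C := by rw [integral_mul_const, hk, one_mul]

lemma support_smoothen_subset (hρ : IsMollifier ρ) {ε : ℝ} (hε : 0 < ε) (u : Euc n → ℝ) :
    Function.support (smoothen ρ ε u) ⊆ Metric.cthickening ε (tsupport u) := by
  intro x hx
  obtain ⟨y, hy, z, hz, rfl⟩ := support_convolution_subset _ hx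
  have h1 := hρ.tsupport_scaled hε (subset_tsupport _ hy)
  refine Metric.mem_cthickening_of_dist_le (y + z) z ε _ (subset_tsupport _ hz) ?_
  simpa [dist_eq_norm] using h1

lemma tsupport_smoothen_subset (hρ : IsMollifier ρ) {ε : ℝ} (hε : 0 < ε) (u : Euc n → ℝ) :
    tsupport (smoothen ρ ε u) ⊆ Metric.cthickening ε (tsupport u) :=
  closure_minimal (hρ.support_smoothen_subset hε u) Metric.isClosed_cthickening

lemma partialDeriv_smoothen (hρ : IsMollifier ρ) (ε : ℝ) {u : Euc n → ℝ}
    (hu : HasCompactSupport u) (hu' : ContDiff ℝ ∞ u) (b : Fin n) :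
    partialDeriv b (smoothen ρ ε u) = smoothen ρ ε (partialDeriv b u) := by
  funext x
  have hk : LocallyIntegrable (scaledKernel ρ ε) :=
    (hρ.continuous_scaled ε).locallyIntegrable
  have h1 : ContDiff ℝ 1 u := hu'.of_le (by simp)
  simp only [partialDeriv, smoothen]
  rw [(hu.hasFDerivAt_convolution_right (ContinuousLinearMap.lsmul ℝ ℝ) hk h1 x).fderiv,
    convolution_precompR_apply _ hk (hu.fderiv ℝ) (h1.continuous_fderiv one_ne_zero)]
  rfl

/-- Mollification is symmetric up to reflecting the kernel. -/
lemma integral_smoothen_mul (hρ : IsMollifier ρ) {ε : ℝ} (hε : 0 < ε) {u h : Euc n → ℝ}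
    (hu : Integrable u) (hh : Continuous h) (hc : HasCompactSupport h) :
    ∫ x, smoothen ρ ε u x * h x = ∫ x, u x * smoothen (fun x => ρ (-x)) ε h x := by
  set k := scaledKernel ρ ε with hkdef
  have hk : Continuous k := hρ.continuous_scaled ε
  have hki : Integrable k := hk.integrable_of_hasCompactSupport (hρ.hasCompactSupport_scaled hε)
  have hmap : MeasurePreserving (MeasurableEquiv.shearAddRight (Euc n))
      (volume.prod volume) (volume.prod volume) :=
    measurePreserving_prod_add volume volume
  obtain ⟨C, hC⟩ := hc.exists_bound_of_continuous hh
  have hint : Integrable (fun p : Euc n × Euc n => k p.1 * u p.2 * h (p.2 + p.1))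
      (volume.prod volume) := by
    refine (hki.mul_prod hu).mul_bdd (c := C) ?_ (ae_of_all _ fun p => hC _)
    exact (hh.comp (continuous_snd.add continuous_fst)).aestronglyMeasurable
  have hint2 : Integrable (fun p : Euc n × Euc n => k p.1 * u (p.2 - p.1) * h p.2)
      (volume.prod volume) := by
    rw [← hmap.integrable_comp_emb (MeasurableEquiv.shearAddRight (Euc n)).measurableEmbedding]
    simpa [Function.comp_def, MeasurableEquiv.shearAddRight, add_comm] using hint
  calc ∫ x, smoothen ρ ε u x * h x = ∫ x, ∫ t, k t * u (x - t) * h x := by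
        refine integral_congr_ae (ae_of_all _ fun x => ?_)
        simp only [smoothen, convolution_def, ContinuousLinearMap.lsmul_apply, smul_eq_mul]
        rw [← integral_mul_const]
    _ = ∫ t, ∫ x, k t * u (x - t) * h x := (integral_integral_swap hint2).symm
    _ = ∫ t, ∫ x, k t * u x * h (x + t) := by
        refine integral_congr_ae (ae_of_all _ fun t => ?_)
        simp only
        rw [← integral_add_right_eq_self (fun x => k t * u (x - t) * h x) t]
        simp
    _ = ∫ x, ∫ t, k t * u x * h (x + t) := integral_integral_swap hint
    _ = _ := by
        refine integral_congr_ae (ae_of_all _ fun x => ?_)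
        simp only [smoothen, convolution_def, ContinuousLinearMap.lsmul_apply, smul_eq_mul]
        rw [← integral_const_mul, ← integral_neg_eq_self]
        refine integral_congr_ae (ae_of_all _ fun t => ?_)
        simp only [hkdef, scaledKernel, smul_neg, sub_eq_add_neg]
        ring

end IsMollifier

/-! ### Weak convergence of mollified Jacobian minors -/

section Calculus

variable {n : ℕ}

lemma contDiff_partialDeriv {u : Euc n → ℝ} (hu : ContDiff ℝ ∞ u) (a : Fin n) :
    ContDiff ℝ ∞ (partialDeriv a u) :=
  (hu.fderiv_right (m := ∞) (by simp)).clm_apply contDiff_const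

lemma hasCompactSupport_partialDeriv {u : Euc n → ℝ} (hu : HasCompactSupport u) (a : Fin n) :
    HasCompactSupport (partialDeriv a u) :=
  hu.fderiv_apply ℝ _

lemma tsupport_partialDeriv_subset (u : Euc n → ℝ) (a : Fin n) :
    tsupport (partialDeriv a u) ⊆ tsupport u :=
  tsupport_fderiv_apply_subset ℝ _

lemma partialDeriv_mul {u h : Euc n → ℝ} (hu : ContDiff ℝ ∞ u) (hh : ContDiff ℝ ∞ h) (a : Fin n)
    (x : Euc n) :
    partialDeriv a (fun y => u y * h y) x =
      partialDeriv a u x * h x + u x * partialDeriv a h x := by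
  simp only [partialDeriv]
  rw [fderiv_fun_mul (hu.differentiable (by simp) x) (hh.differentiable (by simp) x)]
  simp
  ring

lemma partialDeriv_comm {u : Euc n → ℝ} (hu : ContDiff ℝ ∞ u) (a b : Fin n) (x : Euc n) :
    partialDeriv a (partialDeriv b u) x = partialDeriv b (partialDeriv a u) x := by
  have hd : DifferentiableAt ℝ (fderiv ℝ u) x :=
    (hu.fderiv_right (m := ∞) (by simp)).differentiable (by simp) x
  have key : ∀ a b : Fin n, partialDeriv a (partialDeriv b u) x =
      fderiv ℝ (fderiv ℝ u) x (EuclideanSpace.single a 1) (EuclideanSpace.single b 1) := by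
    intro a b
    change fderiv ℝ (fun y => fderiv ℝ u y (EuclideanSpace.single b 1)) x _ = _
    rw [fderiv_clm_apply hd (differentiableAt_const _)]
    simp
  rw [key, key]
  exact hu.contDiffAt.isSymmSndFDerivAt
    (by simpa using WithTop.coe_le_coe.2 (le_top (a := (2 : ℕ∞)))) _ _

lemma integral_partialDeriv_mul {u h : Euc n → ℝ} (hu : ContDiff ℝ ∞ u) (hh : ContDiff ℝ ∞ h)
    (hc : HasCompactSupport h) (a : Fin n) :
    ∫ x, partialDeriv a u x * h x = -∫ x, u x * partialDeriv a h x := by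
  have h1 : Integrable fun x => partialDeriv a u x * h x :=
    ((contDiff_partialDeriv hu a).continuous.mul hh.continuous).integrable_of_hasCompactSupport
      hc.mul_left
  have h2 : Integrable fun x => u x * partialDeriv a h x :=
    (hu.continuous.mul (contDiff_partialDeriv hh a).continuous).integrable_of_hasCompactSupport
      (hasCompactSupport_partialDeriv hc a).mul_left
  have h3 : Integrable fun x => u x * h x :=
    (hu.continuous.mul hh.continuous).integrable_of_hasCompactSupport hc.mul_left
  have := integral_mul_fderiv_eq_neg_fderiv_mul_of_integrable (μ := volume) h1 h2 h3
    (fun x _ => hu.differentiable (by simp) x) (fun x _ => hh.differentiable (by simp) x)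
  simp only [partialDeriv] at this ⊢
  rw [this, neg_neg]

/-- The divergence structure of the minors, in weak form: for smooth `u`, `v`, the minor
`∂_a u ∂_b v - ∂_b u ∂_a v` equals `∂_a (u ∂_b v) - ∂_b (u ∂_a v)`. -/
lemma integral_minor_mul {u v φ : Euc n → ℝ} (hu : ContDiff ℝ ∞ u) (hv : ContDiff ℝ ∞ v)
    (hφ : ContDiff ℝ ∞ φ) (hc : HasCompactSupport φ) (a b : Fin n) :
    ∫ x, (partialDeriv a u x * partialDeriv b v x - partialDeriv b u x * partialDeriv a v x) * φ x =
      (∫ x, partialDeriv a v x * (u x * partialDeriv b φ x)) -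
        ∫ x, partialDeriv b v x * (u x * partialDeriv a φ x) := by
  have hi : ∀ {w z : Euc n → ℝ}, Continuous w → Continuous z → HasCompactSupport z →
      Integrable fun x => w x * z x := fun hw hz hcz =>
    (hw.mul hz).integrable_of_hasCompactSupport hcz.mul_left
  have hcont : ∀ {w : Euc n → ℝ}, ContDiff ℝ ∞ w → ∀ a, Continuous (partialDeriv a w) :=
    fun hw a => (contDiff_partialDeriv hw a).continuous
  have parts : ∀ a b : Fin n, ∫ x, partialDeriv b v x * (partialDeriv a u x * φ x) =
      -(∫ x, partialDeriv a (partialDeriv b v) x * (u x * φ x)) -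
        ∫ x, partialDeriv b v x * (u x * partialDeriv a φ x) := by
    intro a b
    rw [integral_partialDeriv_mul (contDiff_partialDeriv hv b) (hu.mul hφ) hc.mul_left a, neg_neg,
      ← integral_sub]
    · refine integral_congr_ae (ae_of_all _ fun x => ?_)
      simp only [partialDeriv_mul hu hφ]
      ring
    · exact hi (hcont hv b) (hcont (hu.mul hφ) a) (hasCompactSupport_partialDeriv hc.mul_left a)
    · exact hi (hcont hv b) (hu.continuous.mul (hcont hφ a))
        (hasCompactSupport_partialDeriv hc a).mul_left
  have hsplit : ∫ x, (partialDeriv a u x * partialDeriv b v x -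
      partialDeriv b u x * partialDeriv a v x) * φ x =
      (∫ x, partialDeriv b v x * (partialDeriv a u x * φ x)) -
        ∫ x, partialDeriv a v x * (partialDeriv b u x * φ x) := by
    rw [← integral_sub]
    · refine integral_congr_ae (ae_of_all _ fun x => ?_)
      simp only
      ring
    · exact hi (hcont hv b) ((hcont hu a).mul hφ.continuous) hc.mul_left
    · exact hi (hcont hv a) ((hcont hu b).mul hφ.continuous) hc.mul_left
  rw [hsplit, parts a b, parts b a]
  simp only [partialDeriv_comm hv b a]
  ring

end Calculus

/-- The partial derivative `∂_b v` on `G`, in the sense of distributions, is the signed measure with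
density `g` with respect to the positive measure `μ`. -/
def HasMeasureDeriv {n : ℕ} (G : Opens (Euc n)) (v : Euc n → ℝ) (b : Fin n) (μ : Measure (Euc n))
    (g : Euc n → ℝ) : Prop :=
  ∀ ψ : 𝓓(G, ℝ), ∫ x in (G : Set (Euc n)), v x * partialDeriv b ψ x = -∫ x, ψ x * g x ∂μ

section Limit

variable {n : ℕ} {G : Opens (Euc n)} {ρ : Euc n → ℝ}

lemma HasMeasureDeriv.integral_partialDeriv_smoothen_mul {v : Euc n → ℝ} {b : Fin n}
    {μ : Measure (Euc n)} {g : Euc n → ℝ} (hd : HasMeasureDeriv G v b μ g)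
    (hv : IntegrableOn v (G : Set (Euc n))) (hρ : IsMollifier ρ) {ε : ℝ} (hε : 0 < ε)
    {h : Euc n → ℝ} (hh : ContDiff ℝ ∞ h) (hc : HasCompactSupport h)
    (hG : Metric.cthickening ε (tsupport h) ⊆ G) :
    ∫ x, partialDeriv b (smoothen ρ ε ((G : Set (Euc n)).indicator v)) x * h x =
      ∫ x, smoothen (fun y => ρ (-y)) ε h x * g x ∂μ := by
  have hv0 : Integrable ((G : Set (Euc n)).indicator v) :=
    (integrable_indicator_iff G.isOpen.measurableSet).2 hv
  have hsm : ContDiff ℝ ∞ (smoothen (fun y => ρ (-y)) ε h) :=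
    hρ.reflect.contDiff_smoothen hε hh.continuous.locallyIntegrable
  have hts := hρ.reflect.tsupport_smoothen_subset hε h
  let ψ : 𝓓(G, ℝ) := ⟨_, hsm, hc.isCompact.cthickening.of_isClosed_subset (isClosed_tsupport _) hts,
    hts.trans hG⟩
  rw [integral_partialDeriv_mul (hρ.contDiff_smoothen hε hv0.locallyIntegrable) hh hc,
    hρ.integral_smoothen_mul hε hv0 (contDiff_partialDeriv hh b).continuous
      (hasCompactSupport_partialDeriv hc b),
    ← hρ.reflect.partialDeriv_smoothen ε hc hh b]
  have h1 := hd ψ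
  rw [← integral_indicator G.isOpen.measurableSet] at h1
  simp only [Set.indicator_mul_left] at h1
  rw [neg_eq_iff_eq_neg]
  exact h1

/-- Derivatives of mollifications converge weakly, tested against functions that vary with the
mollification parameter. -/
lemma HasMeasureDeriv.tendsto_integral {v : Euc n → ℝ} {b : Fin n}
    {μ : Measure (Euc n)} {g : Euc n → ℝ} (hd : HasMeasureDeriv G v b μ g)
    (hv : IntegrableOn v (G : Set (Euc n))) (hg : Integrable g μ) (hρ : IsMollifier ρ)
    {h : ℝ → Euc n → ℝ} {h₀ : Euc n → ℝ} {K : Set (Euc n)} (hK : IsCompact K) (hKG : K ⊆ G)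
    (hh : ∀ ε, 0 < ε → ContDiff ℝ ∞ (h ε)) (hs : ∀ ε, tsupport (h ε) ⊆ K) {C : ℝ}
    (hC : ∀ᶠ ε in 𝓝[>] (0 : ℝ), ∀ x, |h ε x| ≤ C)
    (hlim : ∀ x, Tendsto (Function.uncurry h) (𝓝[>] 0 ×ˢ 𝓝 x) (𝓝 (h₀ x))) :
    Tendsto (fun ε => ∫ x, partialDeriv b (smoothen ρ ε ((G : Set (Euc n)).indicator v)) x * h ε x)
      (𝓝[>] 0) (𝓝 (∫ x, h₀ x * g x ∂μ)) := by
  have hc : ∀ ε, HasCompactSupport (h ε) := fun ε =>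
    hK.of_isClosed_subset (isClosed_tsupport _) (hs ε)
  obtain ⟨δ, hδ, hδG⟩ := hK.exists_cthickening_subset_open G.isOpen hKG
  have hsmall : ∀ᶠ ε in 𝓝[>] (0 : ℝ), ε ∈ Set.Ioo 0 δ := Ioo_mem_nhdsGT hδ
  have heq : ∀ᶠ ε in 𝓝[>] (0 : ℝ), (∫ x, smoothen (fun y => ρ (-y)) ε (h ε) x * g x ∂μ) =
      ∫ x, partialDeriv b (smoothen ρ ε ((G : Set (Euc n)).indicator v)) x * h ε x := by
    filter_upwards [hsmall] with ε hε
    refine (hd.integral_partialDeriv_smoothen_mul hv hρ hε.1 (hh ε hε.1) (hc ε) ?_).symm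
    exact ((Metric.cthickening_subset_of_subset _ (hs ε)).trans
      (Metric.cthickening_mono hε.2.le _)).trans hδG
  refine Tendsto.congr' heq ?_
  refine tendsto_integral_filter_of_dominated_convergence (fun x => C * |g x|) ?_ ?_ ?_ ?_
  · filter_upwards [hsmall] with ε hε
    have hl : LocallyIntegrable (h ε) := (hh ε hε.1).continuous.locallyIntegrable
    have h1 : Continuous (smoothen (fun y => ρ (-y)) ε (h ε)) :=
      (hρ.reflect.contDiff_smoothen hε.1 hl).continuous
    have h2 : AEStronglyMeasurable (smoothen (fun y => ρ (-y)) ε (h ε)) μ :=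
      h1.aestronglyMeasurable
    exact h2.mul hg.aestronglyMeasurable
  · filter_upwards [hsmall, hC] with ε hε hCε
    refine ae_of_all _ fun x => ?_
    rw [norm_mul, Real.norm_eq_abs, Real.norm_eq_abs]
    refine mul_le_mul_of_nonneg_right ?_ (abs_nonneg _)
    exact hρ.reflect.abs_smoothen_le hε.1 fun y _ => hCε y
  · exact hg.abs.const_mul C
  · refine ae_of_all _ fun x => Tendsto.mul_const _ ?_
    have := hρ.reflect.tendsto_smoothen (x₀ := x) (z := h₀ x) (g := h) ?_ (hlim x)
    · have hp : Tendsto (fun ε : ℝ => (ε, x)) (𝓝[>] 0) (𝓝[>] 0 ×ˢ 𝓝 x) :=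
        tendsto_id.prodMk tendsto_const_nhds
      have h2 := this.comp hp
      simp only [Function.comp_def, Function.uncurry_apply_pair] at h2
      exact h2
    · filter_upwards [hsmall] with ε hε using (hh ε hε.1).continuous.aestronglyMeasurable

/-- The mollifications of a function continuous on `G` converge locally uniformly on `G`. -/
lemma IsMollifier.tendsto_smoothen_indicator (hρ : IsMollifier ρ) {u : Euc n → ℝ}
    (hu : ContinuousOn u (G : Set (Euc n))) {x₀ : Euc n} (hx : x₀ ∈ G) :
    Tendsto (Function.uncurry fun ε => smoothen ρ ε ((G : Set (Euc n)).indicator u))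
      (𝓝[>] 0 ×ˢ 𝓝 x₀) (𝓝 (u x₀)) := by
  refine hρ.tendsto_smoothen (Eventually.of_forall fun _ => ?_) ?_
  · exact (aestronglyMeasurable_indicator_iff G.isOpen.measurableSet).2
      (hu.aestronglyMeasurable G.isOpen.measurableSet)
  · have h1 : Tendsto ((G : Set (Euc n)).indicator u) (𝓝 x₀) (𝓝 (u x₀)) := by
      refine Tendsto.congr' ?_ (hu.continuousAt (G.isOpen.mem_nhds hx))
      filter_upwards [G.isOpen.mem_nhds hx] with y hy using (Set.indicator_of_mem hy _).symm
    exact h1.comp tendsto_snd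

/-- Convergence of the term of the mollified minor that involves `∂_b v`. -/
lemma HasMeasureDeriv.tendsto_integral_smoothen {u v : Euc n → ℝ} {a b : Fin n}
    {μ : Measure (Euc n)} {g : Euc n → ℝ} (hd : HasMeasureDeriv G v b μ g)
    (hu : ContinuousOn u (G : Set (Euc n))) (hui : IntegrableOn u (G : Set (Euc n)))
    (hv : IntegrableOn v (G : Set (Euc n))) (hg : Integrable g μ) (hρ : IsMollifier ρ)
    (φ : 𝓓(G, ℝ)) :
    Tendsto (fun ε => ∫ x, partialDeriv b (smoothen ρ ε ((G : Set (Euc n)).indicator v)) x *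
        (smoothen ρ ε ((G : Set (Euc n)).indicator u) x * partialDeriv a φ x))
      (𝓝[>] 0) (𝓝 (∫ x, (u x * partialDeriv a φ x) * g x ∂μ)) := by
  have hu0 : Integrable ((G : Set (Euc n)).indicator u) :=
    (integrable_indicator_iff G.isOpen.measurableSet).2 hui
  have hφs : ContDiff ℝ ∞ φ := φ.contDiff
  have hcp := φ.hasCompactSupport
  have hpc := (contDiff_partialDeriv hφs a).continuous
  obtain ⟨δ, hδ, hδG⟩ := hcp.isCompact.exists_cthickening_subset_open G.isOpen φ.tsupport_subset
  obtain ⟨M, hM⟩ := (hcp.isCompact.cthickening (r := δ)).exists_bound_of_continuousOn (hu.mono hδG)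
  obtain ⟨B, hB⟩ := (hasCompactSupport_partialDeriv hcp a).exists_bound_of_continuous hpc
  refine hd.tendsto_integral hv hg hρ (h := fun ε x =>
    smoothen ρ ε ((G : Set (Euc n)).indicator u) x * partialDeriv a φ x)
    (h₀ := fun x => u x * partialDeriv a φ x)
    hcp.isCompact φ.tsupport_subset (C := |M| * B) ?_ ?_ ?_ ?_
  · intro ε hε
    exact (hρ.contDiff_smoothen hε hu0.locallyIntegrable).mul (contDiff_partialDeriv hφs a)
  · intro ε
    exact (tsupport_mul_subset_right).trans (tsupport_partialDeriv_subset _ _)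
  · filter_upwards [Ioo_mem_nhdsGT hδ] with ε hε x
    rw [abs_mul]
    by_cases hx : x ∈ tsupport φ
    · refine mul_le_mul ?_ (hB x) (abs_nonneg _) (abs_nonneg _)
      refine hρ.abs_smoothen_le hε.1 fun y hy => ?_
      have hy' : y ∈ Metric.cthickening δ (tsupport φ) :=
        Metric.mem_cthickening_of_dist_le y x δ _ hx ((Metric.mem_closedBall.1 hy).trans hε.2.le)
      rw [Set.indicator_of_mem (hδG hy')]
      exact (hM y hy').trans (le_abs_self _)
    · rw [image_eq_zero_of_notMem_tsupport fun h => hx (tsupport_partialDeriv_subset _ _ h)]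
      simpa using mul_nonneg (abs_nonneg M) ((norm_nonneg _).trans (hB x))
  · intro x
    by_cases hx : x ∈ tsupport φ
    · refine Tendsto.mul (hρ.tendsto_smoothen_indicator hu (φ.tsupport_subset hx)) ?_
      exact (hpc.tendsto x).comp tendsto_snd
    · have h0 : ∀ y ∉ tsupport φ, partialDeriv a φ y = 0 := fun y hy =>
        image_eq_zero_of_notMem_tsupport fun h => hy (tsupport_partialDeriv_subset _ _ h)
      rw [h0 x hx, mul_zero]
      refine tendsto_const_nhds.congr' ?_
      have := tendsto_snd (f := 𝓝[>] (0 : ℝ)) (g := 𝓝 x)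
        |>.eventually ((isClosed_tsupport φ).isOpen_compl.mem_nhds hx)
      filter_upwards [this] with p hp
      simp [Function.uncurry, h0 p.2 hp]

/-- **Weak continuity of Jacobian minors.** For a continuous `u` and a `v` whose derivatives are
measures, the minors of the mollifications converge in distributions, and the limit is obtained
from the formula `∂_a (u ∂_b v) - ∂_b (u ∂_a v)`. -/
theorem tendsto_integral_minor {u v : Euc n → ℝ} {a b : Fin n} {μa μb : Measure (Euc n)}
    {ga gb : Euc n → ℝ} (ha : HasMeasureDeriv G v a μa ga) (hb : HasMeasureDeriv G v b μb gb)
    (hu : ContinuousOn u (G : Set (Euc n))) (hui : IntegrableOn u (G : Set (Euc n)))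
    (hv : IntegrableOn v (G : Set (Euc n))) (hga : Integrable ga μa) (hgb : Integrable gb μb)
    (hρ : IsMollifier ρ) (φ : 𝓓(G, ℝ)) :
    Tendsto (fun ε => ∫ x,
        (partialDeriv a (smoothen ρ ε ((G : Set (Euc n)).indicator u)) x *
            partialDeriv b (smoothen ρ ε ((G : Set (Euc n)).indicator v)) x -
          partialDeriv b (smoothen ρ ε ((G : Set (Euc n)).indicator u)) x *
            partialDeriv a (smoothen ρ ε ((G : Set (Euc n)).indicator v)) x) * φ x)
      (𝓝[>] 0) (𝓝 ((∫ x, (u x * partialDeriv b φ x) * ga x ∂μa) -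
        ∫ x, (u x * partialDeriv a φ x) * gb x ∂μb)) := by
  refine Tendsto.congr' ?_ ((ha.tendsto_integral_smoothen (a := b) hu hui hv hga hρ φ).sub
    (hb.tendsto_integral_smoothen (a := a) hu hui hv hgb hρ φ))
  filter_upwards [self_mem_nhdsWithin] with ε hε
  have hsm : ∀ w, IntegrableOn w (G : Set (Euc n)) →
      ContDiff ℝ ∞ (smoothen ρ ε ((G : Set (Euc n)).indicator w)) := fun w hw =>
    hρ.contDiff_smoothen hε
      ((integrable_indicator_iff G.isOpen.measurableSet).2 hw).locallyIntegrable
  exact (integral_minor_mul (hsm u hui) (hsm v hv) φ.contDiff φ.hasCompactSupport a b).symm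

end Limit

/-! ### Existence of the Jacobian and of the adjugate of the second kind -/

section Minor

variable {n m : ℕ} {G : Opens (Euc n)} {ρ : Euc n → ℝ}

lemma locallyIntegrableOn_mul {u g : Euc n → ℝ} {μ : Measure (Euc n)}
    (hu : ContinuousOn u (G : Set (Euc n))) (hg : Integrable g μ) :
    LocallyIntegrableOn (fun x => u x * g x) (G : Set (Euc n)) μ := by
  rw [locallyIntegrableOn_iff G.isOpen.isLocallyClosed]
  intro K hKG hK
  exact (hg.integrableOn).continuousOn_mul (hu.mono hKG) hK

/-- The distribution `φ ↦ ∫ u ∂_a φ g dμ`, that is `-∂_a (u g μ)`. -/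
lemma exists_distribution_partialDeriv {u g : Euc n → ℝ} {μ : Measure (Euc n)}
    (hu : ContinuousOn u (G : Set (Euc n))) (hg : Integrable g μ) (a : Fin n) :
    ∃ T : 𝓓'(G, ℝ), ∀ φ, T φ = ∫ x, (u x * partialDeriv a φ x) * g x ∂μ := by
  let T : 𝓓(G, ℝ) →L[ℝ] ℝ :=
    (TestFunction.integralAgainstBilinCLM (n := ⊤) (ContinuousLinearMap.mul ℝ ℝ) μ
      (fun x => u x * g x)).comp
      (TestFunction.lineDerivCLM (n := ⊤) (k := ⊤) ℝ (EuclideanSpace.single a (1 : ℝ)))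
  refine ⟨⟨T.toLinearMap, T.cont⟩, fun φ => ?_⟩
  change TestFunction.integralAgainstBilinCLM (n := ⊤) (ContinuousLinearMap.mul ℝ ℝ) μ
      (fun x => u x * g x) (TestFunction.lineDerivCLM (n := ⊤) (k := ⊤) ℝ _ φ) = _
  rw [TestFunction.integralAgainstBilinCLM_eq_integral (locallyIntegrableOn_mul hu hg)]
  refine integral_congr_ae (ae_of_all _ fun x => ?_)
  simp only [TestFunction.lineDerivCLM_eq_fderivCLM,
    TestFunction.fderivCLM_apply_of_le φ (k := ⊤) (by simp), ContinuousLinearMap.mul_apply',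
    partialDeriv]
  ring

/-- The distribution `∂_a (u ∂_b v) - ∂_b (u ∂_a v)`, where `∂_a v = ga μa` and `∂_b v = gb μb`. -/
lemma exists_minor_distribution {u ga gb : Euc n → ℝ} {μa μb : Measure (Euc n)}
    (hu : ContinuousOn u (G : Set (Euc n))) (hga : Integrable ga μa) (hgb : Integrable gb μb)
    (a b : Fin n) :
    ∃ T : 𝓓'(G, ℝ), ∀ φ, T φ = (∫ x, (u x * partialDeriv b φ x) * ga x ∂μa) -
      ∫ x, (u x * partialDeriv a φ x) * gb x ∂μb := by
  obtain ⟨T₁, h₁⟩ := exists_distribution_partialDeriv hu hga b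
  obtain ⟨T₂, h₂⟩ := exists_distribution_partialDeriv hu hgb a
  exact ⟨T₁ - T₂, fun φ => by rw [← h₁, ← h₂]; rfl⟩

lemma contDiff_mollify (hρ : IsMollifier ρ) {ε : ℝ} (hε : 0 < ε) {f : Euc n → Euc m}
    (hf : IntegrableOn f (G : Set (Euc n))) : ContDiff ℝ ∞ (mollify ρ ε G f) := by
  have hf0 : Integrable ((G : Set (Euc n)).indicator f) :=
    (integrable_indicator_iff G.isOpen.measurableSet).2 hf
  exact (hρ.hasCompactSupport_scaled hε).contDiff_convolution_left _ (hρ.contDiff_scaled ε)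
    hf0.locallyIntegrable

lemma mollify_apply (hρ : IsMollifier ρ) {ε : ℝ} (hε : 0 < ε) {f : Euc n → Euc m}
    (hf : IntegrableOn f (G : Set (Euc n))) (x : Euc n) (k : Fin m) :
    mollify ρ ε G f x k = smoothen ρ ε ((G : Set (Euc n)).indicator fun y => f y k) x := by
  have hf0 : Integrable ((G : Set (Euc n)).indicator f) :=
    (integrable_indicator_iff G.isOpen.measurableSet).2 hf
  have hint : ConvolutionExistsAt (scaledKernel ρ ε) ((G : Set (Euc n)).indicator f) x
      (ContinuousLinearMap.lsmul ℝ ℝ) volume :=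
    (hρ.hasCompactSupport_scaled hε).convolutionExists_left _ (hρ.continuous_scaled ε)
      hf0.locallyIntegrable x
  have := (EuclideanSpace.proj k : Euc m →L[ℝ] ℝ).integral_comp_comm hint
  change (EuclideanSpace.proj k : Euc m →L[ℝ] ℝ) (∫ t, _) = ∫ t, _
  refine this.symm.trans ?_
  refine integral_congr_ae (ae_of_all _ fun t => ?_)
  by_cases ht : x - t ∈ (G : Set (Euc n)) <;> simp [Set.indicator, ht]

lemma gradMatrix_mollify (hρ : IsMollifier ρ) {ε : ℝ} (hε : 0 < ε) {f : Euc n → Euc m}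
    (hf : IntegrableOn f (G : Set (Euc n))) (x : Euc n) (k : Fin m) (l : Fin n) :
    gradMatrix (mollify ρ ε G f) x k l =
      partialDeriv l (smoothen ρ ε ((G : Set (Euc n)).indicator fun y => f y k)) x := by
  have hd : DifferentiableAt ℝ (mollify ρ ε G f) x :=
    (contDiff_mollify hρ hε hf).differentiable (by simp) x
  have h1 : smoothen ρ ε ((G : Set (Euc n)).indicator fun y => f y k) =
      (EuclideanSpace.proj k : Euc m →L[ℝ] ℝ) ∘ mollify ρ ε G f :=
    funext fun y => (mollify_apply hρ hε hf y k).symm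
  simp only [gradMatrix, partialDeriv, Matrix.of_apply]
  rw [h1, ((EuclideanSpace.proj k : Euc m →L[ℝ] ℝ).hasFDerivAt.comp x hd.hasFDerivAt).fderiv]
  rfl

lemma ContinuousOn.euc_apply {f : Euc n → Euc m} (hf : ContinuousOn f (G : Set (Euc n)))
    (k : Fin m) : ContinuousOn (fun y => f y k) (G : Set (Euc n)) :=
  (EuclideanSpace.proj k : Euc m →L[ℝ] ℝ).continuous.comp_continuousOn hf

lemma integrableOn_euc_apply {f : Euc n → Euc m} (hf : IntegrableOn f (G : Set (Euc n)))
    (k : Fin m) : IntegrableOn (fun y => f y k) (G : Set (Euc n)) :=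
  (EuclideanSpace.proj k : Euc m →L[ℝ] ℝ).integrable_comp hf

end Minor

/-- A planar continuous map whose second component has measures as derivatives has a distributional
Jacobian. -/
lemma isDistJacobian_of_hasMeasureDeriv {G : Opens (Euc 2)} {g : Euc 2 → Euc 2}
    {μ₀ μ₁ : Measure (Euc 2)} {g₀ g₁ : Euc 2 → ℝ} (hg : ContinuousOn g (G : Set (Euc 2)))
    (hgi : IntegrableOn g (G : Set (Euc 2)))
    (h₀ : HasMeasureDeriv G (fun y => g y 1) 0 μ₀ g₀)
    (h₁ : HasMeasureDeriv G (fun y => g y 1) 1 μ₁ g₁)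
    (hi₀ : Integrable g₀ μ₀) (hi₁ : Integrable g₁ μ₁) {T : 𝓓'(G, ℝ)}
    (hT : ∀ φ, T φ = (∫ x, (g x 0 * partialDeriv 1 φ x) * g₀ x ∂μ₀) -
      ∫ x, (g x 0 * partialDeriv 0 φ x) * g₁ x ∂μ₁) : IsDistJacobian G g T := by
  intro ρ hρ φ
  rw [hT]
  refine Tendsto.congr' ?_ (tendsto_integral_minor h₀ h₁ (hg.euc_apply 0)
    (integrableOn_euc_apply hgi 0) (integrableOn_euc_apply hgi 1) hi₀ hi₁ hρ φ)
  filter_upwards [self_mem_nhdsWithin] with ε hε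
  refine integral_congr_ae (ae_of_all _ fun x => ?_)
  simp only [Matrix.det_fin_two, gradMatrix_mollify hρ hε hgi]

lemma adjugate_apply_cyclic (A : Matrix (Fin 3) (Fin 3) ℝ) (i j : Fin 3) :
    A.adjugate i j =
      A (j + 1) (i + 1) * A (j + 2) (i + 2) - A (j + 1) (i + 2) * A (j + 2) (i + 1) := by
  rw [Matrix.adjugate_fin_three]
  fin_cases i <;> fin_cases j <;> simp [Matrix.of_apply] <;> ring

lemma isAdjSecond_of_hasMeasureDeriv {Ω : Opens (Euc 3)} {f : Euc 3 → Euc 3} {i j : Fin 3}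
    {μ₁ μ₂ : Measure (Euc 3)} {g₁ g₂ : Euc 3 → ℝ} (hf : ContinuousOn f (Ω : Set (Euc 3)))
    (hfi : IntegrableOn f (Ω : Set (Euc 3)))
    (h₁ : HasMeasureDeriv Ω (fun y => f y (j + 2)) (i + 1) μ₁ g₁)
    (h₂ : HasMeasureDeriv Ω (fun y => f y (j + 2)) (i + 2) μ₂ g₂)
    (hi₁ : Integrable g₁ μ₁) (hi₂ : Integrable g₂ μ₂) {T : 𝓓'(Ω, ℝ)}
    (hT : ∀ φ, T φ = (∫ x, (f x (j + 1) * partialDeriv (i + 2) φ x) * g₁ x ∂μ₁) -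
      ∫ x, (f x (j + 1) * partialDeriv (i + 1) φ x) * g₂ x ∂μ₂) : IsAdjSecond Ω f i j T := by
  intro ρ hρ φ
  rw [hT]
  refine Tendsto.congr' ?_ (tendsto_integral_minor h₁ h₂ (hf.euc_apply (j + 1))
    (integrableOn_euc_apply hfi (j + 1)) (integrableOn_euc_apply hfi (j + 2)) hi₁ hi₂ hρ φ)
  filter_upwards [self_mem_nhdsWithin] with ε hε
  refine integral_congr_ae (ae_of_all _ fun x => ?_)
  simp only [adjugate_apply_cyclic, gradMatrix_mollify hρ hε hfi]

/-! ### Uniqueness -/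

lemma exists_isMollifier (n : ℕ) : ∃ ρ : Euc n → ℝ, IsMollifier ρ := by
  let b : ContDiffBump (0 : Euc n) := ⟨1 / 2, 1, by norm_num, by norm_num⟩
  refine ⟨b.normed volume, ?_, ?_, ?_, ?_⟩
  · exact b.contDiff_normed
  · exact fun x => b.nonneg_normed x
  · rw [b.tsupport_normed_eq]
  · exact b.integral_normed

lemma IsDistJacobian.unique {G : Opens (Euc 2)} {g : Euc 2 → Euc 2} {S T : 𝓓'(G, ℝ)}
    (hS : IsDistJacobian G g S) (hT : IsDistJacobian G g T) : S = T := by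
  obtain ⟨ρ, hρ⟩ := exists_isMollifier 2
  ext φ
  exact tendsto_nhds_unique (hS ρ hρ φ) (hT ρ hρ φ)

lemma IsAdjSecond.unique {Ω : Opens (Euc 3)} {f : Euc 3 → Euc 3} {i j : Fin 3} {S T : 𝓓'(Ω, ℝ)}
    (hS : IsAdjSecond Ω f i j S) (hT : IsAdjSecond Ω f i j T) : S = T := by
  obtain ⟨ρ, hρ⟩ := exists_isMollifier 3
  ext φ
  exact tendsto_nhds_unique (hS ρ hρ φ) (hT ρ hρ φ)

lemma IsAdjFirst.unique {Ω : Opens (Euc 3)} {f : Euc 3 → Euc 3} {i j : Fin 3} {S T : 𝓓'(Ω, ℝ)}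
    (hS : IsAdjFirst Ω f i j S) (hT : IsAdjFirst Ω f i j T) : S = T := by
  obtain ⟨s, hs, hs'⟩ := hS
  obtain ⟨t, ht, ht'⟩ := hT
  ext φ
  rw [(hs' φ).2, (ht' φ).2]
  refine integral_congr_ae ?_
  filter_upwards [hs, ht] with τ h1 h2
  rw [IsDistJacobian.unique h1 h2]

/-! ### The coordinates `(t, y) ↦ κ_i^t(y)` -/

/-- The coordinates `(x_{i'}, x_{i''})` of a point of `ℝ³`. -/
def slicePoint (i : Fin 3) (x : Euc 3) : Euc 2 := WithLp.toLp 2 ![x (i + 1), x (i + 2)]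

lemma kappa_apply_self (i : Fin 3) (t : ℝ) (y : Euc 2) : kappa i t y i = t := by simp [kappa]

lemma slicePoint_kappa (i : Fin 3) (t : ℝ) (y : Euc 2) : slicePoint i (kappa i t y) = y := by
  ext k
  fin_cases i <;> fin_cases k <;> simp [kappa, slicePoint]

lemma kappa_slicePoint (i : Fin 3) (x : Euc 3) : kappa i (x i) (slicePoint i x) = x := by
  ext k
  fin_cases i <;> fin_cases k <;> simp [kappa, slicePoint]

lemma continuous_slicePoint (i : Fin 3) : Continuous (slicePoint i) := by
  unfold slicePoint; fun_prop

lemma contDiff_slicePoint (i : Fin 3) : ContDiff ℝ ∞ (slicePoint i) := by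
  rw [contDiff_euclidean]
  intro k
  fin_cases k <;> simp [slicePoint] <;> fun_prop

lemma continuous_kappa_uncurry (i : Fin 3) : Continuous fun p : ℝ × Euc 2 => kappa i p.1 p.2 := by
  unfold kappa
  refine (PiLp.continuous_toLp 2 _).comp (continuous_pi fun k => ?_)
  split_ifs <;> fun_prop

/-- The homeomorphism `(t, y) ↦ κ_i^t(y)`. -/
def kappaHomeo (i : Fin 3) : ℝ × Euc 2 ≃ₜ Euc 3 where
  toFun p := kappa i p.1 p.2
  invFun x := (x i, slicePoint i x)
  left_inv p := by simp [kappa_apply_self, slicePoint_kappa]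
  right_inv x := kappa_slicePoint i x
  continuous_toFun := continuous_kappa_uncurry i
  continuous_invFun := Continuous.prodMk (by fun_prop) (continuous_slicePoint i)

@[simp] lemma kappaHomeo_apply (i : Fin 3) (p : ℝ × Euc 2) : kappaHomeo i p = kappa i p.1 p.2 := rfl

lemma kappaHomeo_symm_apply (i : Fin 3) (x : Euc 3) :
    (kappaHomeo i).symm x = (x i, slicePoint i x) := rfl

lemma measurePreserving_kappaHomeo (i : Fin 3) :
    MeasurePreserving (kappaHomeo i) (volume.prod volume) volume := by
  have h1 : MeasurePreserving (Prod.map id (WithLp.ofLp : Euc 2 → Fin 2 → ℝ))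
      ((volume : Measure ℝ).prod volume) (volume.prod volume) :=
    (MeasurePreserving.id volume).prod (PiLp.volume_preserving_ofLp (Fin 2))
  have h2 := (volume_preserving_piFinSuccAbove (fun _ : Fin 3 => ℝ) 0).symm
  have h3 := volume_measurePreserving_piCongrLeft (fun _ : Fin 3 => ℝ) (Equiv.addRight i)
  have h4 := PiLp.volume_preserving_toLp (Fin 3)
  refine (congrArg (fun F => MeasurePreserving F (volume.prod volume) volume) ?_).mp
    (h4.comp (h3.comp (h2.comp h1)))
  symm
  funext p
  ext k
  obtain ⟨k, rfl⟩ := (Equiv.addRight i).surjective k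
  simp only [Function.comp_apply, MeasurableEquiv.coe_piCongrLeft, kappaHomeo_apply]
  rw [Equiv.piCongrLeft_apply_apply]
  fin_cases i <;> fin_cases k <;>
    simp [kappa, MeasurableEquiv.piFinSuccAbove, Fin.insertNthEquiv] <;> rfl

/-- The linear part of `κ_i^t`. -/
def kappaLin (i : Fin 3) : Euc 2 →L[ℝ] Euc 3 :=
  LinearMap.toContinuousLinearMap
    { toFun := kappa i 0
      map_add' := fun x y => by
        ext k
        simp only [kappa, PiLp.add_apply]
        split_ifs <;> simp
      map_smul' := fun c x => by
        ext k
        simp only [kappa, PiLp.smul_apply, RingHom.id_apply]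
        split_ifs <;> simp }

lemma kappa_eq (i : Fin 3) (t : ℝ) (y : Euc 2) : kappa i t y = kappa i t 0 + kappaLin i y := by
  change _ = kappa i t 0 + kappa i 0 y
  ext k
  simp only [kappa, PiLp.add_apply]
  split_ifs <;> simp

lemma hasFDerivAt_kappa (i : Fin 3) (t : ℝ) (y : Euc 2) :
    HasFDerivAt (kappa i t) (kappaLin i) y := by
  have : kappa i t = fun y => kappa i t 0 + kappaLin i y := funext (kappa_eq i t)
  rw [this]
  exact (kappaLin i).hasFDerivAt.const_add _

lemma kappaLin_single_zero (i : Fin 3) :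
    kappaLin i (EuclideanSpace.single 0 1) = EuclideanSpace.single (i + 1) 1 := by
  change kappa i 0 _ = _
  ext k
  fin_cases i <;> fin_cases k <;> simp [kappa]

lemma kappaLin_single_one (i : Fin 3) :
    kappaLin i (EuclideanSpace.single 1 1) = EuclideanSpace.single (i + 2) 1 := by
  change kappa i 0 _ = _
  ext k
  fin_cases i <;> fin_cases k <;> simp [kappa]

lemma fderiv_comp_kappa {φ : Euc 3 → ℝ} (hφ : ContDiff ℝ ∞ φ) (i : Fin 3) (t : ℝ) (y : Euc 2) :
    fderiv ℝ (φ ∘ kappa i t) y = (fderiv ℝ φ (kappa i t y)).comp (kappaLin i) :=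
  ((hφ.differentiable (by simp) _).hasFDerivAt.comp y (hasFDerivAt_kappa i t y)).fderiv

/-- The coordinate direction of `ℝ³` that corresponds to a coordinate direction of the slices. -/
def sliceDir (i : Fin 3) (b : Fin 2) : Fin 3 := if b = 0 then i + 1 else i + 2

lemma partialDeriv_comp_kappa {φ : Euc 3 → ℝ} (hφ : ContDiff ℝ ∞ φ) (i : Fin 3) (b : Fin 2) (t : ℝ)
    (y : Euc 2) :
    partialDeriv b (φ ∘ kappa i t) y = partialDeriv (sliceDir i b) φ (kappa i t y) := by
  simp only [partialDeriv, fderiv_comp_kappa hφ, ContinuousLinearMap.comp_apply]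
  fin_cases b
  · simp [sliceDir, kappaLin_single_zero]
  · simp [sliceDir, kappaLin_single_one]

@[simp] lemma sliceTest_apply {Ω : Opens (Euc 3)} (i : Fin 3) (t : ℝ) (φ : 𝓓(Ω, ℝ)) (y : Euc 2) :
    sliceTest i t φ y = φ (kappa i t y) := rfl

lemma coe_sliceTest {Ω : Opens (Euc 3)} (i : Fin 3) (t : ℝ) (φ : 𝓓(Ω, ℝ)) :
    (sliceTest i t φ : Euc 2 → ℝ) = φ ∘ kappa i t := rfl

/-- The product `a(x_i) φ(x)`, as a test function. -/
def mulCoord {Ω : Opens (Euc 3)} (i : Fin 3) (a : ℝ → ℝ) (ha : ContDiff ℝ ∞ a) (φ : 𝓓(Ω, ℝ)) :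
    𝓓(Ω, ℝ) where
  toFun x := a (x i) * φ x
  contDiff' := (ha.comp (by fun_prop)).mul φ.contDiff
  hasCompactSupport' := φ.hasCompactSupport.mul_left
  tsupport_subset' := tsupport_mul_subset_right.trans φ.tsupport_subset

@[simp] lemma mulCoord_apply {Ω : Opens (Euc 3)} (i : Fin 3) (a : ℝ → ℝ) (ha : ContDiff ℝ ∞ a)
    (φ : 𝓓(Ω, ℝ)) (x : Euc 3) : mulCoord i a ha φ x = a (x i) * φ x := rfl

lemma sliceTest_mulCoord {Ω : Opens (Euc 3)} (i : Fin 3) (a : ℝ → ℝ) (ha : ContDiff ℝ ∞ a)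
    (φ : 𝓓(Ω, ℝ)) (t : ℝ) : sliceTest i t (mulCoord i a ha φ) = a t • sliceTest i t φ := by
  ext y
  simp [kappa_apply_self]

/-- Every test function on a slice is the restriction of a test function on `Ω`. -/
lemma exists_sliceTest_eq {Ω : Opens (Euc 3)} {i : Fin 3} {t : ℝ} (ψ : 𝓓(sliceOpens Ω i t, ℝ)) :
    ∃ φ : 𝓓(Ω, ℝ), sliceTest i t φ = ψ := by
  have hK := ψ.hasCompactSupport.isCompact
  have hsub : ({t} : Set ℝ) ×ˢ tsupport ψ ⊆ kappaHomeo i ⁻¹' (Ω : Set (Euc 3)) := by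
    rintro ⟨s, y⟩ ⟨hs, hy⟩
    rw [Set.mem_singleton_iff] at hs
    subst hs
    exact ψ.tsupport_subset hy
  obtain ⟨U, V, hU, -, htU, hKV, hUV⟩ := generalized_tube_lemma isCompact_singleton hK
    (Ω.isOpen.preimage (kappaHomeo i).continuous) hsub
  obtain ⟨r, hr, hrU⟩ := Metric.isOpen_iff.1 hU t (htU rfl)
  let χ : ContDiffBump t := ⟨r / 4, r / 2, by positivity, by linarith⟩
  have hχt : tsupport χ ⊆ U := by
    rw [χ.tsupport_eq]
    exact (Metric.closedBall_subset_ball (by simp only [χ]; linarith)).trans hrU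
  have hχψ : tsupport (fun x : Euc 3 => χ (x i) * ψ (slicePoint i x)) ⊆
      kappaHomeo i '' (tsupport χ ×ˢ tsupport ψ) := by
    refine closure_minimal (fun x hx => ?_) ?_
    · have hx' : χ (x i) * ψ (slicePoint i x) ≠ 0 := hx
      refine ⟨(x i, slicePoint i x), ⟨?_, ?_⟩, kappa_slicePoint i x⟩
      · exact subset_tsupport _ (left_ne_zero_of_mul hx')
      · exact subset_tsupport _ (right_ne_zero_of_mul hx')
    · exact (kappaHomeo i).isClosedMap _ ((isClosed_tsupport _).prod (isClosed_tsupport _))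
  refine ⟨⟨fun x => χ (x i) * ψ (slicePoint i x), ?_, ?_, ?_⟩, ?_⟩
  · exact (χ.contDiff.comp (by fun_prop)).mul (ψ.contDiff.comp (contDiff_slicePoint i))
  · exact ((χ.hasCompactSupport.isCompact.prod hK).image (kappaHomeo i).continuous)
      |>.of_isClosed_subset (isClosed_tsupport _) hχψ
  · refine hχψ.trans ?_
    rintro _ ⟨p, ⟨hp1, hp2⟩, rfl⟩
    exact hUV ⟨hχt hp1, hKV hp2⟩
  · ext y
    change χ (kappa i t y i) * ψ (slicePoint i (kappa i t y)) = ψ y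
    rw [kappa_apply_self, slicePoint_kappa,
      χ.one_of_mem_closedBall (Metric.mem_closedBall_self χ.rIn_pos.le),
      one_mul]

/-! ### A countable `C¹`-dense family of test functions -/

lemma exists_compact_exhaustion_opens {n : ℕ} (Ω : Opens (Euc n)) :
    ∃ K : ℕ → Set (Euc n), (∀ k, IsCompact (K k)) ∧ (∀ k, K k ⊆ Ω) ∧
      ∀ C, IsCompact C → C ⊆ Ω → ∃ k, C ⊆ K k := by
  have : LocallyCompactSpace Ω := Ω.isOpen.locallyCompactSpace
  let E : CompactExhaustion Ω := default
  refine ⟨fun k => (↑) '' E k, fun k => (E.isCompact k).image continuous_subtype_val, ?_, ?_⟩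
  · rintro k _ ⟨x, -, rfl⟩
    exact x.2
  · intro C hC hCΩ
    have hC' : IsCompact ((↑) ⁻¹' C : Set Ω) := by
      rw [Subtype.isCompact_iff]
      convert hC
      ext x
      simpa using fun h => hCΩ h
    obtain ⟨k, hk⟩ := E.exists_superset_of_isCompact hC'
    exact ⟨k, fun x hx => ⟨⟨x, hCΩ hx⟩, hk hx, rfl⟩⟩

/-- The test functions contain a countable family that is dense for `C¹` convergence with supports
in a fixed compact set. -/
lemma exists_countable_dense_testFunction {n : ℕ} (Ω : Opens (Euc n)) :
    ∃ D : Set 𝓓(Ω, ℝ), D.Countable ∧ ∀ φ : 𝓓(Ω, ℝ), ∃ K : Set (Euc n), IsCompact K ∧ K ⊆ Ω ∧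
      ∀ ε > 0, ∃ ψ ∈ D, tsupport (ψ - φ) ⊆ K ∧
        ∀ x, |ψ x - φ x| ≤ ε ∧ ‖fderiv ℝ (ψ - φ) x‖ ≤ ε := by
  obtain ⟨K, hK, hKΩ, hex⟩ := exists_compact_exhaustion_opens Ω
  let X : ℕ → Type := fun k => {φ : 𝓓(Ω, ℝ) // tsupport φ ⊆ K k}
  have hC1 : ∀ φ : 𝓓(Ω, ℝ), ContDiff ℝ 1 φ := fun φ => φ.contDiff.of_le (by simp)
  let F : ∀ k, X k → C(Euc n, ℝ × (Euc n →L[ℝ] ℝ)) := fun k φ =>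
    ⟨fun x => (φ.1 x, fderiv ℝ φ.1 x),
      φ.1.continuous.prodMk ((hC1 φ.1).continuous_fderiv one_ne_zero)⟩
  -- The topology of locally uniform convergence of `(φ, Dφ)` is second countable.
  have hdense : ∀ k, ∃ D : Set (X k), D.Countable ∧ ∀ φ : X k, ∀ ε > 0, ∃ ψ ∈ D,
      ∀ x ∈ K k, dist (F k ψ x) (F k φ x) < ε := by
    intro k
    let : TopologicalSpace (X k) := TopologicalSpace.induced (F k) inferInstance
    have : SecondCountableTopology (X k) := secondCountableTopology_induced _ _ _
    obtain ⟨D, hDc, hD⟩ := TopologicalSpace.exists_countable_dense (X k)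
    refine ⟨D, hDc, fun φ ε hε => ?_⟩
    have hcont : Tendsto (F k) (𝓝 φ) (𝓝 (F k φ)) := continuous_induced_dom.tendsto φ
    have hunif := (ContinuousMap.tendsto_iff_forall_isCompact_tendstoUniformlyOn.1 hcont)
      (K k) (hK k)
    have hev := Metric.tendstoUniformlyOn_iff.1 hunif ε hε
    obtain ⟨ψ, hψ, hψD⟩ := (hD.inter_nhds_nonempty hev)
    exact ⟨ψ, hψ, fun x hx => by rw [dist_comm]; exact hψD x hx⟩
  choose D hDc hD using hdense
  refine ⟨⋃ k, (↑) '' D k, Set.countable_iUnion fun k => (hDc k).image _, fun φ => ?_⟩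
  obtain ⟨k, hk⟩ := hex (tsupport φ) φ.hasCompactSupport φ.tsupport_subset
  refine ⟨K k, hK k, hKΩ k, fun ε hε => ?_⟩
  obtain ⟨ψ, hψD, hψ⟩ := hD k ⟨φ, hk⟩ ε hε
  have hsupp : tsupport (ψ.1 - φ) ⊆ K k :=
    (tsupport_sub _ _).trans (Set.union_subset ψ.2 hk)
  refine ⟨ψ.1, Set.mem_iUnion.2 ⟨k, ψ, hψD, rfl⟩, hsupp, fun x => ?_⟩
  have hfd : fderiv ℝ (ψ.1 - φ) x = fderiv ℝ ψ.1 x - fderiv ℝ φ x :=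
    fderiv_sub ((hC1 ψ.1).differentiable one_ne_zero x) ((hC1 φ).differentiable one_ne_zero x)
  by_cases hx : x ∈ K k
  · have h := hψ x hx
    rw [Prod.dist_eq, max_lt_iff] at h
    refine ⟨?_, ?_⟩
    · rw [← Real.dist_eq]; exact h.1.le
    · rw [hfd, ← dist_eq_norm]; exact h.2.le
  · have h1 : (ψ.1 - φ) x = 0 := image_eq_zero_of_notMem_tsupport fun h => hx (hsupp h)
    have h2 : fderiv ℝ (ψ.1 - φ) x = 0 :=
      image_eq_zero_of_notMem_tsupport fun h => hx (hsupp (tsupport_fderiv_subset ℝ h))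
    refine ⟨?_, by rw [h2, norm_zero]; exact hε.le⟩
    have : ψ.1 x - φ x = 0 := h1
    rw [this, abs_zero]
    exact hε.le

/-! ### Densities of measures on the line -/

/-- If `s dt = r dm` as measures on the line, then `s` is `r` times the density of the absolutely
continuous part of `m`. -/
lemma ae_eq_rnDeriv_mul_of_integral_eq {m : Measure ℝ} [IsFiniteMeasure m] {s r : ℝ → ℝ}
    (hs : Integrable s) (hr : Integrable r m)
    (h : ∀ a : ℝ → ℝ, ContDiff ℝ ∞ a → HasCompactSupport a →
      ∫ t, a t * s t = ∫ t, a t * r t ∂m) :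
    ∀ᵐ t, s t = (m.rnDeriv volume t).toReal * r t := by
  -- Both measures have densities with respect to their sum, so that the fundamental lemma of the
  -- calculus of variations applies to one locally integrable function.
  set ν : Measure ℝ := m + volume with hν
  have hm : m ≪ ν := Measure.absolutelyContinuous_of_le (Measure.le_add_right le_rfl)
  have hv : volume ≪ ν := Measure.absolutelyContinuous_of_le (Measure.le_add_left le_rfl)
  have hs' : Integrable (fun t => ((volume : Measure ℝ).rnDeriv ν t).toReal • s t) ν :=
    (integrable_rnDeriv_smul_iff hv).2 hs
  have hr' : Integrable (fun t => (m.rnDeriv ν t).toReal • r t) ν :=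
    (integrable_rnDeriv_smul_iff hm).2 hr
  have hzero := ae_eq_zero_of_integral_contDiff_smul_eq_zero (hs'.sub hr').locallyIntegrable (by
    intro a ha hac
    obtain ⟨C, hC⟩ := hac.exists_bound_of_continuous ha.continuous
    have i1 : Integrable (fun t => ((volume : Measure ℝ).rnDeriv ν t).toReal • (a t * s t)) ν :=
      (integrable_rnDeriv_smul_iff hv).2
        (hs.bdd_mul ha.continuous.aestronglyMeasurable (ae_of_all _ hC))
    have i2 : Integrable (fun t => (m.rnDeriv ν t).toReal • (a t * r t)) ν :=
      (integrable_rnDeriv_smul_iff hm).2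
        (hr.bdd_mul ha.continuous.aestronglyMeasurable (ae_of_all _ hC))
    have : ∀ t, a t • ((fun t => ((volume : Measure ℝ).rnDeriv ν t).toReal • s t) -
        fun t => (m.rnDeriv ν t).toReal • r t) t =
        ((volume : Measure ℝ).rnDeriv ν t).toReal • (a t * s t) -
          (m.rnDeriv ν t).toReal • (a t * r t) := fun t => by
      simp only [Pi.sub_apply, smul_eq_mul]; ring
    simp_rw [this]
    rw [integral_sub i1 i2, integral_rnDeriv_smul hv, integral_rnDeriv_smul hm, h a ha hac,
      sub_self])
  filter_upwards [hv hzero, Measure.rnDeriv_eq_div_rnDeriv_add m volume,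
    Measure.rnDeriv_pos hv, hv ((volume : Measure ℝ).rnDeriv_lt_top ν)] with t h1 h2 h3 h4
  have hp : 0 < ((volume : Measure ℝ).rnDeriv ν t).toReal := ENNReal.toReal_pos h3.ne' h4.ne
  rw [h2, ← hν, ENNReal.toReal_div, div_mul_eq_mul_div, eq_div_iff hp.ne']
  simp only [Pi.sub_apply, smul_eq_mul] at h1
  linarith

/-! ### Slicing a measure by parallel planes -/

/-- The measure `μ` in the coordinates `(t, y)`, where `x = κ_i^t(y)`. -/
def coordMeasure (μ : Measure (Euc 3)) (i : Fin 3) : Measure (ℝ × Euc 2) :=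
  μ.map (kappaHomeo i).symm

instance (μ : Measure (Euc 3)) [IsFiniteMeasure μ] (i : Fin 3) :
    IsFiniteMeasure (coordMeasure μ i) := by
  unfold coordMeasure; infer_instance

/-- The conditional probability measures of `μ` on the planes `{x_i = t}`. -/
def sliceKernel (μ : Measure (Euc 3)) [IsFiniteMeasure μ] (i : Fin 3) :
    ProbabilityTheory.Kernel ℝ (Euc 2) :=
  (coordMeasure μ i).condKernel

instance (μ : Measure (Euc 3)) [IsFiniteMeasure μ] (i : Fin 3) :
    ProbabilityTheory.IsMarkovKernel (sliceKernel μ i) := by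
  unfold sliceKernel; infer_instance

/-- The density, with respect to Lebesgue measure, of the absolutely continuous part of the
projection of `μ` to the `x_i`-axis. -/
def sliceDensity (μ : Measure (Euc 3)) (i : Fin 3) (t : ℝ) : ℝ :=
  ((coordMeasure μ i).fst.rnDeriv volume t).toReal

section Slicing

variable {μ : Measure (Euc 3)} {i : Fin 3}

lemma sliceDensity_nonneg (t : ℝ) : 0 ≤ sliceDensity μ i t := ENNReal.toReal_nonneg

lemma integrable_sliceDensity [IsFiniteMeasure μ] : Integrable (sliceDensity μ i) :=
  Measure.integrable_toReal_rnDeriv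

lemma integrable_comp_kappaHomeo {F : Euc 3 → ℝ} (hF : Integrable F μ) :
    Integrable (fun p : ℝ × Euc 2 => F (kappa i p.1 p.2)) (coordMeasure μ i) := by
  rw [coordMeasure, (kappaHomeo i).symm.measurableEmbedding.integrable_map_iff]
  refine hF.congr (ae_of_all _ fun x => ?_)
  simp [kappaHomeo_symm_apply, kappa_slicePoint]

/-- Fubini's theorem for the disintegration of `μ` into its slices. -/
lemma integral_integral_sliceKernel [IsFiniteMeasure μ] {F : Euc 3 → ℝ} (hF : Integrable F μ) :
    ∫ t, ∫ y, F (kappa i t y) ∂sliceKernel μ i t ∂(coordMeasure μ i).fst = ∫ x, F x ∂μ := by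
  rw [sliceKernel, Measure.integral_condKernel (integrable_comp_kappaHomeo hF),
    coordMeasure, (kappaHomeo i).symm.measurableEmbedding.integral_map]
  refine integral_congr_ae (ae_of_all _ fun x => ?_)
  simp [kappaHomeo_symm_apply, kappa_slicePoint]

/-- The functional `S` on test functions is of order at most one: it is bounded, on test functions
supported in a fixed compact set, by the `C¹` norm. -/
def IsOrderLEOne {n : ℕ} {G : Opens (Euc n)} (S : 𝓓'(G, ℝ)) : Prop :=
  ∀ K : Set (Euc n), IsCompact K → K ⊆ G → ∃ C : ℝ, ∀ ψ : 𝓓(G, ℝ), tsupport ψ ⊆ K →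
    ∀ B : ℝ, (∀ y, |ψ y| ≤ B ∧ ‖fderiv ℝ ψ y‖ ≤ B) → |S ψ| ≤ C * B

lemma integrable_mul_of_abs_le {n : ℕ} {κ : Measure (Euc n)} [IsFiniteMeasure κ] {h τ : Euc n → ℝ}
    {C : ℝ} (hh : Continuous h) (hc : HasCompactSupport h) (hτ : Measurable τ)
    (hC : ∀ y, |τ y| ≤ C) : Integrable (fun y => h y * τ y) κ :=
  (hh.integrable_of_hasCompactSupport hc).mul_bdd (c := C) hτ.aestronglyMeasurable (ae_of_all _ hC)

/-- **Slicing of distributions that are measures.** If the integral over `t` of distributions `S_t`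
of order at most one on the slices is the measure `σ μ`, then almost every `S_t` is a measure,
namely the corresponding slice of `σ μ`. -/
theorem ae_eq_integral_sliceKernel [IsFiniteMeasure μ] {Ω : Opens (Euc 3)} {σ : Euc 3 → ℝ}
    (hσ : Measurable σ) (hσ1 : ∀ x, |σ x| ≤ 1) {S : ∀ t : ℝ, 𝓓'(sliceOpens Ω i t, ℝ)}
    (hS : ∀ φ : 𝓓(Ω, ℝ), Integrable (fun t => S t (sliceTest i t φ)) ∧
      ∫ t, S t (sliceTest i t φ) = ∫ x, φ x * σ x ∂μ)
    (hord : ∀ᵐ t, IsOrderLEOne (S t)) :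
    ∀ᵐ t, ∀ ψ : 𝓓(sliceOpens Ω i t, ℝ), S t ψ =
      ∫ y, ψ y * (sliceDensity μ i t * σ (kappa i t y)) ∂sliceKernel μ i t := by
  have hint : ∀ φ : 𝓓(Ω, ℝ), Integrable (fun x => φ x * σ x) μ := fun φ =>
    integrable_mul_of_abs_le φ.continuous φ.hasCompactSupport hσ hσ1
  -- For a single test function, with a null set that depends on it: test with `a(x_i) φ(x)`.
  have hone : ∀ φ : 𝓓(Ω, ℝ), ∀ᵐ t, S t (sliceTest i t φ) = sliceDensity μ i t *
      ∫ y, φ (kappa i t y) * σ (kappa i t y) ∂sliceKernel μ i t := by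
    intro φ
    refine ae_eq_rnDeriv_mul_of_integral_eq (hS φ).1 ?_ fun a ha hac => ?_
    · exact (integrable_comp_kappaHomeo (i := i) (hint φ)).integral_condKernel
    · have h1 := (hS (mulCoord i a ha φ)).2
      simp only [sliceTest_mulCoord, map_smul, smul_eq_mul] at h1
      rw [h1, ← integral_integral_sliceKernel (i := i) (hint (mulCoord i a ha φ))]
      refine integral_congr_ae (ae_of_all _ fun t => ?_)
      simp only [mulCoord_apply, kappa_apply_self, mul_assoc]
      rw [integral_const_mul]
  -- Both sides are continuous in the `C¹` norm, so a countable dense family gives one null set.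
  obtain ⟨D, hDc, hD⟩ := exists_countable_dense_testFunction Ω
  have hall := (ae_ball_iff hDc).2 fun φ _ => hone φ
  filter_upwards [hall, hord] with t ht hordt
  intro ψ
  obtain ⟨φ, rfl⟩ := exists_sliceTest_eq ψ
  obtain ⟨K, hK, hKΩ, hdense⟩ := hD φ
  obtain ⟨C, hC⟩ := hordt (kappa i t ⁻¹' K)
    ((isClosedEmbedding_kappa i t).isCompact_preimage hK) fun y hy => hKΩ hy
  have hστ : Measurable fun y => σ (kappa i t y) := hσ.comp (continuous_kappa i t).measurable
  have hint2 : ∀ χ : 𝓓(Ω, ℝ),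
      Integrable (fun y => χ (kappa i t y) * σ (kappa i t y)) (sliceKernel μ i t) := fun χ =>
    integrable_mul_of_abs_le (sliceTest i t χ).continuous (sliceTest i t χ).hasCompactSupport hστ
      fun y => hσ1 _
  set R : 𝓓(Ω, ℝ) → ℝ := fun χ => sliceDensity μ i t *
    ∫ y, χ (kappa i t y) * σ (kappa i t y) ∂sliceKernel μ i t with hR
  have hgoal : S t (sliceTest i t φ) = R φ := by
    set L := ‖kappaLin i‖
    have hL : 0 ≤ L := norm_nonneg _
    have hc := sliceDensity_nonneg (μ := μ) (i := i) t
    refine eq_of_forall_dist_le fun η hη => ?_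
    set M := |C| * (1 + L) + sliceDensity μ i t + 1 with hM
    have hMpos : 0 < M := by positivity
    obtain ⟨χ, hχD, hχK, hχ⟩ := hdense (η / M) (div_pos hη hMpos)
    set ε := η / M with hε
    have hεpos : 0 < ε := div_pos hη hMpos
    have e1 : S t (sliceTest i t χ) = R χ := ht χ hχD
    have e2 : |S t (sliceTest i t (χ - φ))| ≤ C * ((1 + L) * ε) := by
      refine hC _ ?_ _ fun y => ⟨?_, ?_⟩
      · exact (tsupport_comp_subset_preimage _ (continuous_kappa i t)).trans
          (Set.preimage_mono hχK)
      · have := (hχ (kappa i t y)).1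
        have h2 : |sliceTest i t (χ - φ) y| ≤ ε := this
        nlinarith
      · rw [coe_sliceTest, fderiv_comp_kappa (χ - φ).contDiff]
        refine (ContinuousLinearMap.opNorm_comp_le _ _).trans ?_
        have := (hχ (kappa i t y)).2
        have h3 : ‖fderiv ℝ (χ - φ : 𝓓(Ω, ℝ)) (kappa i t y)‖ ≤ ε := this
        nlinarith [mul_le_mul_of_nonneg_right h3 hL]
    have e3 : S t (sliceTest i t (χ - φ)) =
        S t (sliceTest i t χ) - S t (sliceTest i t φ) := by
      rw [← map_sub]; rfl
    have e4 : |R χ - R φ| ≤ sliceDensity μ i t * ε := by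
      rw [hR]
      simp only
      rw [← mul_sub, abs_mul, abs_of_nonneg hc, ← integral_sub (hint2 χ) (hint2 φ)]
      refine mul_le_mul_of_nonneg_left ?_ hc
      have := norm_integral_le_of_norm_le_const (μ := sliceKernel μ i t) (C := ε)
        (f := fun y => χ (kappa i t y) * σ (kappa i t y) - φ (kappa i t y) * σ (kappa i t y))
        (ae_of_all _ fun y => by
          rw [← sub_mul, norm_mul, Real.norm_eq_abs, Real.norm_eq_abs]
          exact (mul_le_of_le_one_right (abs_nonneg _) (hσ1 _)).trans (hχ _).1)
      simpa using this
    have e5 : C * ((1 + L) * ε) ≤ |C| * ((1 + L) * ε) :=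
      mul_le_mul_of_nonneg_right (le_abs_self C) (by positivity)
    have e6 : M * ε = η := mul_div_cancel₀ η hMpos.ne'
    rw [Real.dist_eq]
    calc |S t (sliceTest i t φ) - R φ|
        = |(R χ - R φ) - S t (sliceTest i t (χ - φ))| := by rw [e3, e1]; congr 1; ring
      _ ≤ |R χ - R φ| + |S t (sliceTest i t (χ - φ))| := abs_sub _ _
      _ ≤ η := by rw [← e6, hM]; nlinarith
  rw [hgoal, hR]
  simp only [sliceTest_apply]
  rw [← integral_const_mul]
  refine integral_congr_ae (ae_of_all _ fun y => ?_)
  simp only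
  ring

end Slicing

/-! ### Signed measures as densities -/

lemma integrable_toSignedMeasure {n : ℕ} {μ : Measure (Euc n)} [IsFiniteMeasure μ]
    {φ : Euc n → ℝ} (h : Integrable φ μ) : μ.toSignedMeasure.Integrable φ := by
  rw [VectorMeasure.Integrable, Measure.variation_toSignedMeasure]
  exact h

lemma integral_smul_toSignedMeasure {n : ℕ} (μ : Measure (Euc n)) [IsFiniteMeasure μ]
    (φ : Euc n → ℝ) : ∫ᵛ x, φ x ∂•μ.toSignedMeasure = ∫ x, φ x ∂μ := by
  have h : (ContinuousLinearMap.lsmul ℝ ℝ : ℝ →L[ℝ] ℝ →L[ℝ] ℝ) =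
      (ContinuousLinearMap.lsmul ℝ ℝ).flip := by
    ext; simp
  rw [h]
  exact VectorMeasure.integral_toSignedMeasure

/-- The polar decomposition of a signed measure. -/
lemma exists_polar_decomposition {n : ℕ} (ν : SignedMeasure (Euc n)) :
    ∃ (μ : Measure (Euc n)) (σ : Euc n → ℝ), IsFiniteMeasure μ ∧ Measurable σ ∧
      (∀ x, |σ x| ≤ 1) ∧ ∀ φ : Euc n → ℝ, Continuous φ → HasCompactSupport φ →
        ∫ᵛ x, φ x ∂•ν = ∫ x, φ x * σ x ∂μ := by
  set J := ν.toJordanDecomposition with hJ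
  obtain ⟨N, hN, hpN, hnN⟩ := J.mutuallySingular
  classical
  set σ : Euc n → ℝ := fun x => if x ∈ N then -1 else 1 with hσ
  have hσm : Measurable σ := Measurable.ite hN measurable_const measurable_const
  have hσ1 : ∀ x, |σ x| ≤ 1 := fun x => by
    simp only [hσ]; split_ifs <;> simp
  refine ⟨J.posPart + J.negPart, σ, inferInstance, hσm, hσ1, fun φ hφ hc => ?_⟩
  have hp : Integrable φ J.posPart := hφ.integrable_of_hasCompactSupport hc
  have hn : Integrable φ J.negPart := hφ.integrable_of_hasCompactSupport hc
  have h1 : ν = J.posPart.toSignedMeasure - J.negPart.toSignedMeasure :=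
    (SignedMeasure.toSignedMeasure_toJordanDecomposition ν).symm
  rw [h1, VectorMeasure.integral_sub_vectorMeasure (integrable_toSignedMeasure hp)
    (integrable_toSignedMeasure hn), integral_smul_toSignedMeasure,
    integral_smul_toSignedMeasure,
    integral_add_measure (integrable_mul_of_abs_le hφ hc hσm hσ1)
      (integrable_mul_of_abs_le hφ hc hσm hσ1), sub_eq_add_neg, ← integral_neg]
  congr 1
  · refine integral_congr_ae ?_
    have : ∀ᵐ x ∂J.posPart, x ∉ N := measure_eq_zero_iff_ae_notMem.1 hpN
    filter_upwards [this] with x hx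
    simp [hσ, hx]
  · refine integral_congr_ae ?_
    have : ∀ᵐ x ∂J.negPart, x ∉ Nᶜ := measure_eq_zero_iff_ae_notMem.1 hnN
    filter_upwards [this] with x hx
    simp only [Set.mem_compl_iff, not_not] at hx
    simp [hσ, hx]

lemma integral_withDensityᵥ {n : ℕ} {κ : Measure (Euc n)} {g φ : Euc n → ℝ}
    (hg : Integrable g κ) (hφ : Continuous φ) (hc : HasCompactSupport φ) :
    ∫ᵛ x, φ x ∂•(κ.withDensityᵥ g) = ∫ x, φ x * g x ∂κ := by
  have f1 : IsFiniteMeasure (κ.withDensity fun x => ENNReal.ofReal (g x)) :=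
    isFiniteMeasure_withDensity_ofReal hg.2
  have f2 : IsFiniteMeasure (κ.withDensity fun x => ENNReal.ofReal (-g x)) :=
    isFiniteMeasure_withDensity_ofReal hg.neg.2
  obtain ⟨C, hC⟩ := hc.exists_bound_of_continuous hφ
  have key : ∀ w : Euc n → ℝ, Integrable w κ →
      Integrable (fun x => (ENNReal.ofReal (w x)).toReal • φ x) κ := fun w hw => by
    have h1 : Integrable (fun x => (ENNReal.ofReal (w x)).toReal) κ :=
      hw.real_toNNReal.congr (ae_of_all _ fun x => by simp [ENNReal.ofReal])
    exact h1.mul_bdd (c := C) hφ.aestronglyMeasurable (ae_of_all _ hC)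
  have step : ∀ w : Euc n → ℝ, Integrable w κ →
      ∫ x, φ x ∂(κ.withDensity fun x => ENNReal.ofReal (w x)) =
        ∫ x, (ENNReal.ofReal (w x)).toReal • φ x ∂κ := fun w hw =>
    integral_withDensity_eq_integral_toReal_smul₀
      hw.aestronglyMeasurable.aemeasurable.ennreal_ofReal
      (ae_of_all _ fun x => ENNReal.ofReal_lt_top) _
  rw [withDensityᵥ_eq_withDensity_pos_part_sub_withDensity_neg_part hg,
    VectorMeasure.integral_sub_vectorMeasure
      (integrable_toSignedMeasure (hφ.integrable_of_hasCompactSupport hc))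
      (integrable_toSignedMeasure (hφ.integrable_of_hasCompactSupport hc)),
    integral_smul_toSignedMeasure, integral_smul_toSignedMeasure,
    step g hg, step (fun x => -g x) hg.neg, ← integral_sub (key g hg) (key (fun x => -g x) hg.neg)]
  refine integral_congr_ae (ae_of_all _ fun x => ?_)
  simp only [smul_eq_mul, ← sub_mul]
  rcases le_total 0 (g x) with h | h
  · rw [ENNReal.toReal_ofReal h, ENNReal.ofReal_of_nonpos (by linarith), ENNReal.toReal_zero]
    ring
  · rw [ENNReal.ofReal_of_nonpos h, ENNReal.toReal_ofReal (by linarith), ENNReal.toReal_zero]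
    ring

/-! ### Integrals over slices -/

section SliceIntegral

variable {μ : Measure (Euc 3)} [IsFiniteMeasure μ] {i : Fin 3}

lemma measurable_integral_sliceKernel {H : Euc 3 → ℝ} (hH : Measurable H) :
    Measurable fun t => ∫ y, H (kappa i t y) ∂sliceKernel μ i t := by
  have h1 : StronglyMeasurable (Function.uncurry fun (t : ℝ) (y : Euc 2) => H (kappa i t y)) :=
    (hH.comp (continuous_kappa_uncurry i).measurable).stronglyMeasurable
  exact (h1.integral_kernel_prod_right (κ := sliceKernel μ i)).measurable

lemma abs_integral_sliceKernel_le {H : Euc 3 → ℝ} {C : ℝ} (hC : ∀ x, |H x| ≤ C) (t : ℝ) :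
    |∫ y, H (kappa i t y) ∂sliceKernel μ i t| ≤ C := by
  have := norm_integral_le_of_norm_le_const (μ := sliceKernel μ i t) (C := C)
    (f := fun y => H (kappa i t y)) (ae_of_all _ fun y => hC _)
  simpa using this

lemma integrable_sliceDensity_mul {H : Euc 3 → ℝ} {C : ℝ} (hH : Measurable H)
    (hC : ∀ x, |H x| ≤ C) :
    Integrable fun t => sliceDensity μ i t * ∫ y, H (kappa i t y) ∂sliceKernel μ i t :=
  integrable_sliceDensity.mul_bdd (c := C) (measurable_integral_sliceKernel hH).aestronglyMeasurable
    (ae_of_all _ (abs_integral_sliceKernel_le hC))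

/-- If `σ μ` is the integral of its slices when tested against smooth functions, then this is also
the case for continuous functions. -/
lemma integral_sliceDensity_mul {Ω : Opens (Euc 3)} {σ : Euc 3 → ℝ} (hσ : Measurable σ)
    (hσ1 : ∀ x, |σ x| ≤ 1)
    (hμ : ∀ φ : 𝓓(Ω, ℝ), ∫ t, sliceDensity μ i t *
      ∫ y, φ (kappa i t y) * σ (kappa i t y) ∂sliceKernel μ i t = ∫ x, φ x * σ x ∂μ)
    {h : Euc 3 → ℝ} (hh : Continuous h) (hc : HasCompactSupport h) (hΩ : tsupport h ⊆ Ω) :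
    ∫ t, sliceDensity μ i t * ∫ y, h (kappa i t y) * σ (kappa i t y) ∂sliceKernel μ i t =
      ∫ x, h x * σ x ∂μ := by
  obtain ⟨ρ, hρ⟩ := exists_isMollifier 3
  obtain ⟨δ, hδ, hδΩ⟩ := hc.isCompact.exists_cthickening_subset_open Ω.isOpen hΩ
  obtain ⟨C, hC⟩ := hc.exists_bound_of_continuous hh
  have hsmall : ∀ᶠ ε in 𝓝[>] (0 : ℝ), ε ∈ Set.Ioo 0 δ := Ioo_mem_nhdsGT hδ
  have hlh : LocallyIntegrable h := hh.locallyIntegrable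
  have hsm : ∀ ε, 0 < ε → Continuous (smoothen ρ ε h) := fun ε hε =>
    (hρ.contDiff_smoothen hε hlh).continuous
  have hbd : ∀ ε, 0 < ε → ∀ x, |smoothen ρ ε h x * σ x| ≤ C := fun ε hε x => by
    rw [abs_mul]
    exact (mul_le_of_le_one_right (abs_nonneg _) (hσ1 x)).trans
      (hρ.abs_smoothen_le hε fun y _ => hC y)
  have hpt : ∀ x, Tendsto (fun ε => smoothen ρ ε h x * σ x) (𝓝[>] 0) (𝓝 (h x * σ x)) := by
    intro x
    refine Tendsto.mul_const _ ?_
    have h1 : Tendsto (Function.uncurry fun (_ : ℝ) => h) (𝓝[>] 0 ×ˢ 𝓝 x) (𝓝 (h x)) :=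
      (hh.tendsto x).comp tendsto_snd
    have h2 := hρ.tendsto_smoothen (g := fun _ => h)
      (Eventually.of_forall fun _ => hh.aestronglyMeasurable) h1
    have hp : Tendsto (fun ε : ℝ => (ε, x)) (𝓝[>] 0) (𝓝[>] 0 ×ˢ 𝓝 x) :=
      tendsto_id.prodMk tendsto_const_nhds
    have h3 := h2.comp hp
    simp only [Function.comp_def, Function.uncurry_apply_pair] at h3
    exact h3
  have hright : Tendsto (fun ε => ∫ x, smoothen ρ ε h x * σ x ∂μ) (𝓝[>] 0)
      (𝓝 (∫ x, h x * σ x ∂μ)) := by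
    refine tendsto_integral_filter_of_dominated_convergence (fun _ => C) ?_ ?_
      (integrable_const C) (ae_of_all _ hpt)
    · filter_upwards [hsmall] with ε hε
      exact ((hsm ε hε.1).measurable.mul hσ).aestronglyMeasurable
    · filter_upwards [hsmall] with ε hε using ae_of_all _ (hbd ε hε.1)
  have hleft : Tendsto (fun ε => ∫ t, sliceDensity μ i t *
      ∫ y, smoothen ρ ε h (kappa i t y) * σ (kappa i t y) ∂sliceKernel μ i t) (𝓝[>] 0)
      (𝓝 (∫ t, sliceDensity μ i t *
        ∫ y, h (kappa i t y) * σ (kappa i t y) ∂sliceKernel μ i t)) := by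
    refine tendsto_integral_filter_of_dominated_convergence (fun t => sliceDensity μ i t * C) ?_ ?_
      (integrable_sliceDensity.mul_const C) ?_
    · filter_upwards [hsmall] with ε hε
      exact (integrable_sliceDensity_mul ((hsm ε hε.1).measurable.mul hσ)
        (hbd ε hε.1)).aestronglyMeasurable
    · filter_upwards [hsmall] with ε hε
      refine ae_of_all _ fun t => ?_
      rw [norm_mul, Real.norm_eq_abs, abs_of_nonneg (sliceDensity_nonneg t)]
      exact mul_le_mul_of_nonneg_left
        (abs_integral_sliceKernel_le (H := fun x => smoothen ρ ε h x * σ x) (hbd ε hε.1) t)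
        (sliceDensity_nonneg t)
    · refine ae_of_all _ fun t => Tendsto.const_mul _ ?_
      refine tendsto_integral_filter_of_dominated_convergence (fun _ => C) ?_ ?_
        (integrable_const C) (ae_of_all _ fun y => hpt _)
      · filter_upwards [hsmall] with ε hε
        exact (((hsm ε hε.1).measurable.mul hσ).comp
          (continuous_kappa i t).measurable).aestronglyMeasurable
      · filter_upwards [hsmall] with ε hε using ae_of_all _ fun y => hbd ε hε.1 _
  refine tendsto_nhds_unique (hleft.congr' ?_) hright
  filter_upwards [hsmall] with ε hε
  have hts := hρ.tsupport_smoothen_subset hε.1 h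
  exact hμ ⟨smoothen ρ ε h, hρ.contDiff_smoothen hε.1 hlh,
    hc.isCompact.cthickening.of_isClosed_subset (isClosed_tsupport _) hts,
    hts.trans ((Metric.cthickening_mono hε.2.le _).trans hδΩ)⟩

end SliceIntegral

/-! ### Slices of functions whose derivative is a measure -/

lemma abs_partialDeriv_le {n : ℕ} (u : Euc n → ℝ) (a : Fin n) (x : Euc n) :
    |partialDeriv a u x| ≤ ‖fderiv ℝ u x‖ := by
  have := (fderiv ℝ u x).le_opNorm (EuclideanSpace.single a 1)
  simpa [partialDeriv] using this

lemma abs_integral_partialDeriv_le {n : ℕ} {G : Opens (Euc n)} {u g : Euc n → ℝ}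
    {μ : Measure (Euc n)} (hu : ContinuousOn u (G : Set (Euc n))) (hg : Integrable g μ) (a : Fin n)
    {K : Set (Euc n)} (hK : IsCompact K) (hKG : K ⊆ G) :
    ∃ C : ℝ, ∀ ψ : 𝓓(G, ℝ), tsupport ψ ⊆ K →
      ∀ B : ℝ, (∀ y, |ψ y| ≤ B ∧ ‖fderiv ℝ ψ y‖ ≤ B) →
        |∫ x, (u x * partialDeriv a ψ x) * g x ∂μ| ≤ C * B := by
  obtain ⟨M, hM⟩ := hK.exists_bound_of_continuousOn (hu.mono hKG)
  refine ⟨∫ x, |M| * |g x| ∂μ, fun ψ hψ B hB => ?_⟩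
  rw [← integral_mul_const]
  rw [← Real.norm_eq_abs]
  refine norm_integral_le_of_norm_le ((hg.abs.const_mul _).mul_const _) (ae_of_all _ fun x => ?_)
  have hB0 : 0 ≤ B := (abs_nonneg _).trans (hB x).1
  rw [norm_mul, norm_mul, Real.norm_eq_abs, Real.norm_eq_abs, Real.norm_eq_abs]
  have hux : |u x| * |partialDeriv a ψ x| ≤ |M| * B := by
    by_cases hx : x ∈ K
    · exact mul_le_mul ((hM x hx).trans (le_abs_self _))
        ((abs_partialDeriv_le _ _ _).trans (hB x).2) (abs_nonneg _) (abs_nonneg _)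
    · rw [image_eq_zero_of_notMem_tsupport
        fun h => hx (hψ (tsupport_partialDeriv_subset _ _ h)), abs_zero, mul_zero]
      positivity
  calc |u x| * |partialDeriv a ψ x| * |g x| ≤ |M| * B * |g x| :=
        mul_le_mul_of_nonneg_right hux (abs_nonneg _)
    _ = |M| * |g x| * B := by ring

lemma ae_integrableOn_comp_kappa {E : Type*} [NormedAddCommGroup E] {Ω : Opens (Euc 3)}
    {v : Euc 3 → E} (hv : IntegrableOn v (Ω : Set (Euc 3))) (i : Fin 3) :
    ∀ᵐ t, IntegrableOn (fun y => v (kappa i t y)) (sliceOpens Ω i t : Set (Euc 2)) := by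
  have hv0 := (integrable_indicator_iff Ω.isOpen.measurableSet).2 hv
  have h1 := ((measurePreserving_kappaHomeo i).integrable_comp_emb
    (kappaHomeo i).measurableEmbedding).2 hv0
  filter_upwards [h1.prod_right_ae] with t ht
  rw [← integrable_indicator_iff (sliceOpens Ω i t).isOpen.measurableSet]
  exact ht

/-- **Slices of functions of bounded variation.** If `∂_l v` is a measure, where `x_l` is a
coordinate of the planes `{x_i = t}`, then for almost every `t` the derivative of the restriction of
`v` to the plane is the slice of this measure. Moreover the measure is the integral of its slices
when tested against smooth functions. -/
theorem HasMeasureDeriv.slice {Ω : Opens (Euc 3)} {v : Euc 3 → ℝ} {i : Fin 3} {b : Fin 2}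
    {μ : Measure (Euc 3)} [IsFiniteMeasure μ] {σ : Euc 3 → ℝ} (hσ : Measurable σ)
    (hσ1 : ∀ x, |σ x| ≤ 1) (hv : IntegrableOn v (Ω : Set (Euc 3)))
    (hd : HasMeasureDeriv Ω v (sliceDir i b) μ σ) :
    (∀ᵐ t, HasMeasureDeriv (sliceOpens Ω i t) (fun y => v (kappa i t y)) b (sliceKernel μ i t)
      fun y => sliceDensity μ i t * σ (kappa i t y)) ∧
    ∀ φ : 𝓓(Ω, ℝ), ∫ t, sliceDensity μ i t *
      ∫ y, φ (kappa i t y) * σ (kappa i t y) ∂sliceKernel μ i t = ∫ x, φ x * σ x ∂μ := by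
  have hv0 : Integrable ((Ω : Set (Euc 3)).indicator v) :=
    (integrable_indicator_iff Ω.isOpen.measurableSet).2 hv
  have hvt := ae_integrableOn_comp_kappa hv i
  -- `S t` is the distributional derivative `∂_b` of the slice of `v`; for the exceptional `t` where
  -- the slice is not integrable it is an arbitrary distribution.
  have hex : ∀ t, ∃ S : 𝓓'(sliceOpens Ω i t, ℝ),
      IntegrableOn (fun y => v (kappa i t y)) (sliceOpens Ω i t : Set (Euc 2)) →
      ∀ ψ, S ψ = -∫ y, (1 * partialDeriv b ψ y) *
        (sliceOpens Ω i t : Set (Euc 2)).indicator (fun y => v (kappa i t y)) y := by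
    intro t
    by_cases ht : IntegrableOn (fun y => v (kappa i t y)) (sliceOpens Ω i t : Set (Euc 2))
    · obtain ⟨T, hT⟩ := exists_distribution_partialDeriv (G := sliceOpens Ω i t)
        (u := fun _ => 1) continuousOn_const
        ((integrable_indicator_iff (sliceOpens Ω i t).isOpen.measurableSet).2 ht) b
      exact ⟨-T, fun _ ψ => by rw [← hT]; rfl⟩
    · exact ⟨0, fun h => absurd h ht⟩
  choose S hS using hex
  have hint : ∀ φ : 𝓓(Ω, ℝ), Integrable
      (fun x => (Ω : Set (Euc 3)).indicator v x * partialDeriv (sliceDir i b) φ x) := fun φ => by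
    have hpc := (contDiff_partialDeriv φ.contDiff (sliceDir i b)).continuous
    obtain ⟨C, hC⟩ := (hasCompactSupport_partialDeriv φ.hasCompactSupport
      (sliceDir i b)).exists_bound_of_continuous hpc
    exact hv0.mul_bdd (c := C) hpc.aestronglyMeasurable (ae_of_all _ hC)
  have hprod := fun φ => ((measurePreserving_kappaHomeo i).integrable_comp_emb
    (kappaHomeo i).measurableEmbedding).2 (hint φ)
  have hSφ : ∀ φ : 𝓓(Ω, ℝ), (fun t => -∫ y, (Ω : Set (Euc 3)).indicator v (kappa i t y) *
      partialDeriv (sliceDir i b) φ (kappa i t y)) =ᵐ[volume]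
        fun t => S t (sliceTest i t φ) := fun φ => by
    filter_upwards [hvt] with t ht
    rw [hS t ht]
    congr 1
    refine integral_congr_ae (ae_of_all _ fun y => ?_)
    simp only [coe_sliceTest, partialDeriv_comp_kappa φ.contDiff, one_mul]
    rw [mul_comm]
    rfl
  have hmain : ∀ φ : 𝓓(Ω, ℝ), Integrable (fun t => S t (sliceTest i t φ)) ∧
      ∫ t, S t (sliceTest i t φ) = ∫ x, φ x * σ x ∂μ := by
    intro φ
    refine ⟨((hprod φ).integral_prod_left.neg).congr (hSφ φ), ?_⟩
    rw [← integral_congr_ae (hSφ φ), integral_neg]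
    have h1 := integral_prod _ (hprod φ)
    have h2 := (measurePreserving_kappaHomeo i).integral_comp (kappaHomeo i).measurableEmbedding
      (fun x => (Ω : Set (Euc 3)).indicator v x * partialDeriv (sliceDir i b) φ x)
    have h3 := hd φ
    rw [← integral_indicator Ω.isOpen.measurableSet] at h3
    simp only [Set.indicator_mul_left] at h3
    rw [neg_eq_iff_eq_neg, ← h3, ← h2]
    exact h1.symm
  have hord : ∀ᵐ t, IsOrderLEOne (S t) := by
    filter_upwards [hvt] with t ht
    intro K hK hKG
    obtain ⟨C, hC⟩ := abs_integral_partialDeriv_le (G := sliceOpens Ω i t) (u := fun _ => 1)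
      continuousOn_const
      ((integrable_indicator_iff (sliceOpens Ω i t).isOpen.measurableSet).2 ht) b hK hKG
    exact ⟨C, fun ψ hψ B hB => by rw [hS t ht, abs_neg]; exact hC ψ hψ B hB⟩
  have hrep := ae_eq_integral_sliceKernel hσ hσ1 hmain hord
  refine ⟨?_, fun φ => ?_⟩
  · filter_upwards [hrep, hvt] with t ht hvt ψ
    rw [← ht ψ, hS t hvt, neg_neg, ← integral_indicator (sliceOpens Ω i t).isOpen.measurableSet]
    refine integral_congr_ae (ae_of_all _ fun y => ?_)
    simp only [Set.indicator_mul_left, one_mul]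
    rw [mul_comm]
  · rw [← (hmain φ).2]
    refine integral_congr_ae ?_
    filter_upwards [hrep] with t ht
    rw [ht, ← integral_const_mul]
    refine integral_congr_ae (ae_of_all _ fun y => ?_)
    simp only [sliceTest_apply]
    ring

/-! ### Comparison of the two kinds of adjugates -/

lemma continuous_mul_partialDeriv {n : ℕ} {G : Opens (Euc n)} {u : Euc n → ℝ}
    (hu : ContinuousOn u (G : Set (Euc n))) (a : Fin n) (φ : 𝓓(G, ℝ)) :
    Continuous fun x => u x * partialDeriv a φ x := by
  refine continuous_of_tsupport fun x hx => ?_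
  have hxG : x ∈ (G : Set (Euc n)) := φ.tsupport_subset
    (tsupport_partialDeriv_subset _ _ (tsupport_mul_subset_right hx))
  exact (hu.continuousAt (G.isOpen.mem_nhds hxG)).mul
    (contDiff_partialDeriv φ.contDiff a).continuous.continuousAt

lemma MemBV.exists_hasMeasureDeriv {n m : ℕ} {Ω : Opens (Euc n)} {f : Euc n → Euc m}
    (hf : MemBV Ω f) (k : Fin m) (l : Fin n) :
    ∃ (μ : Measure (Euc n)) (σ : Euc n → ℝ), IsFiniteMeasure μ ∧ Measurable σ ∧
      (∀ x, |σ x| ≤ 1) ∧ HasMeasureDeriv Ω (fun x => f x k) l μ σ := by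
  obtain ⟨ν, hν⟩ := hf.2 k l
  obtain ⟨μ, σ, hμ, hσ, hσ1, h⟩ := exists_polar_decomposition ν
  exact ⟨μ, σ, hμ, hσ, hσ1, fun ψ => (hν ψ).trans (by rw [h ψ ψ.continuous ψ.hasCompactSupport])⟩

section Slices

variable {Ω : Opens (Euc 3)} {f : Euc 3 → Euc 3}

lemma continuousOn_sliceMap (hf : ContinuousOn f (Ω : Set (Euc 3))) (i j : Fin 3) (t : ℝ) :
    ContinuousOn (sliceMap f i j t) (sliceOpens Ω i t : Set (Euc 2)) := by
  have h : ∀ k, ContinuousOn (fun y => f (kappa i t y) k) (sliceOpens Ω i t : Set (Euc 2)) :=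
    fun k => (hf.euc_apply k).comp (continuous_kappa i t).continuousOn fun y hy => hy
  refine (PiLp.continuous_toLp 2 _).comp_continuousOn (continuousOn_pi.2 fun k => ?_)
  fin_cases k
  · exact h (j + 1)
  · exact h (j + 2)

lemma ae_integrableOn_sliceMap (hf : IntegrableOn f (Ω : Set (Euc 3))) (i j : Fin 3) :
    ∀ᵐ t, IntegrableOn (sliceMap f i j t) (sliceOpens Ω i t : Set (Euc 2)) := by
  filter_upwards [ae_integrableOn_comp_kappa (integrableOn_euc_apply hf (j + 1)) i,
    ae_integrableOn_comp_kappa (integrableOn_euc_apply hf (j + 2)) i] with t h1 h2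
  have h : ∀ k : Fin 2, Integrable
      (fun y => (![f (kappa i t y) (j + 1), f (kappa i t y) (j + 2)] : Fin 2 → ℝ) k)
      (volume.restrict (sliceOpens Ω i t : Set (Euc 2))) := by
    intro k
    fin_cases k
    · exact h1
    · exact h2
  exact (PiLp.continuousLinearEquiv 2 ℝ (fun _ : Fin 2 => ℝ)).symm.toContinuousLinearMap
    |>.integrable_comp (Integrable.of_eval h)

lemma integrable_slice_density {μ : Measure (Euc 3)} [IsFiniteMeasure μ] {σ : Euc 3 → ℝ}
    (hσ : Measurable σ) (hσ1 : ∀ x, |σ x| ≤ 1) (i : Fin 3) (t : ℝ) :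
    Integrable (fun y => sliceDensity μ i t * σ (kappa i t y)) (sliceKernel μ i t) :=
  (Integrable.of_bound (hσ.comp (continuous_kappa i t).measurable).aestronglyMeasurable 1
    (ae_of_all _ fun _ => hσ1 _)).const_mul _

/-- Each of the two terms of the slice Jacobians integrates, with respect to `t`, to the
corresponding term of the adjugate. -/
lemma integral_slice_term {u v : Euc 3 → ℝ} {i : Fin 3} {b : Fin 2} {μ : Measure (Euc 3)}
    [IsFiniteMeasure μ] {σ : Euc 3 → ℝ} (hσ : Measurable σ) (hσ1 : ∀ x, |σ x| ≤ 1)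
    (hu : ContinuousOn u (Ω : Set (Euc 3))) (hv : IntegrableOn v (Ω : Set (Euc 3)))
    (hd : HasMeasureDeriv Ω v (sliceDir i b) μ σ) (a : Fin 2) (φ : 𝓓(Ω, ℝ)) :
    Integrable (fun t => ∫ y, (u (kappa i t y) * partialDeriv a (sliceTest i t φ) y) *
      (sliceDensity μ i t * σ (kappa i t y)) ∂sliceKernel μ i t) ∧
    ∫ t, ∫ y, (u (kappa i t y) * partialDeriv a (sliceTest i t φ) y) *
      (sliceDensity μ i t * σ (kappa i t y)) ∂sliceKernel μ i t =
        ∫ x, (u x * partialDeriv (sliceDir i a) φ x) * σ x ∂μ := by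
  set h : Euc 3 → ℝ := fun x => u x * partialDeriv (sliceDir i a) φ x with hh
  have hcont : Continuous h := continuous_mul_partialDeriv hu _ φ
  have hcs : HasCompactSupport h :=
    (hasCompactSupport_partialDeriv φ.hasCompactSupport _).mul_left
  have hts : tsupport h ⊆ Ω := tsupport_mul_subset_right.trans
    ((tsupport_partialDeriv_subset _ _).trans φ.tsupport_subset)
  obtain ⟨C, hC⟩ := hcs.exists_bound_of_continuous hcont
  have heq : ∀ t, ∫ y, (u (kappa i t y) * partialDeriv a (sliceTest i t φ) y) *
      (sliceDensity μ i t * σ (kappa i t y)) ∂sliceKernel μ i t =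
      sliceDensity μ i t * ∫ y, h (kappa i t y) * σ (kappa i t y) ∂sliceKernel μ i t := by
    intro t
    rw [← integral_const_mul]
    refine integral_congr_ae (ae_of_all _ fun y => ?_)
    simp only [coe_sliceTest, partialDeriv_comp_kappa φ.contDiff, hh]
    ring
  simp_rw [heq]
  refine ⟨integrable_sliceDensity_mul (H := fun x => h x * σ x) (C := C)
    (hcont.measurable.mul hσ) fun x => ?_, ?_⟩
  · rw [abs_mul]
    exact (mul_le_of_le_one_right (abs_nonneg _) (hσ1 x)).trans (hC x)
  · exact integral_sliceDensity_mul hσ hσ1 (hd.slice hσ hσ1 hv).2 hcont hcs hts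

/-- Both kinds of adjugates exist and agree, and the slice Jacobians are of order at most one. -/
theorem exists_adjugate (hcont : ContinuousOn f (Ω : Set (Euc 3))) (hBV : MemBV Ω f)
    (i j : Fin 3) :
    ∃ (T : 𝓓'(Ω, ℝ)) (S : ∀ t : ℝ, 𝓓'(sliceOpens Ω i t, ℝ)), IsAdjSecond Ω f i j T ∧
      (∀ᵐ t : ℝ, IsSliceJacobian Ω f i j t (S t)) ∧
      (∀ φ : 𝓓(Ω, ℝ), Integrable (fun t : ℝ => S t (sliceTest i t φ)) ∧
        T φ = ∫ t : ℝ, S t (sliceTest i t φ)) ∧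
      ∀ t, IsOrderLEOne (S t) := by
  obtain ⟨μ₀, σ₀, _, hσ₀, hσ₀1, hd₀⟩ := hBV.exists_hasMeasureDeriv (j + 2) (sliceDir i 0)
  obtain ⟨μ₁, σ₁, _, hσ₁, hσ₁1, hd₁⟩ := hBV.exists_hasMeasureDeriv (j + 2) (sliceDir i 1)
  have hu := hcont.euc_apply (j + 1)
  have hv := integrableOn_euc_apply hBV.1 (j + 2)
  have hi : ∀ {μ : Measure (Euc 3)} [IsFiniteMeasure μ] {σ : Euc 3 → ℝ}, Measurable σ →
      (∀ x, |σ x| ≤ 1) → Integrable σ μ := fun hσ h1 =>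
    Integrable.of_bound hσ.aestronglyMeasurable 1 (ae_of_all _ h1)
  obtain ⟨T, hT⟩ := exists_minor_distribution hu (hi (μ := μ₀) hσ₀ hσ₀1) (hi (μ := μ₁) hσ₁ hσ₁1)
    (i + 1) (i + 2)
  have hut : ∀ t, ContinuousOn (fun y => f (kappa i t y) (j + 1))
      (sliceOpens Ω i t : Set (Euc 2)) := fun t =>
    hu.comp (continuous_kappa i t).continuousOn fun y hy => hy
  have hg₀ := integrable_slice_density (μ := μ₀) hσ₀ hσ₀1 i
  have hg₁ := integrable_slice_density (μ := μ₁) hσ₁ hσ₁1 i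
  choose S hS using fun t => exists_minor_distribution (hut t) (hg₀ t) (hg₁ t) 0 1
  refine ⟨T, S, ?_, ?_, fun φ => ?_, fun t => ?_⟩
  · exact isAdjSecond_of_hasMeasureDeriv hcont hBV.1 hd₀ hd₁ (hi hσ₀ hσ₀1) (hi hσ₁ hσ₁1) hT
  · filter_upwards [(hd₀.slice hσ₀ hσ₀1 hv).1, (hd₁.slice hσ₁ hσ₁1 hv).1,
      ae_integrableOn_sliceMap hBV.1 i j] with t h₀ h₁ hti
    exact isDistJacobian_of_hasMeasureDeriv (continuousOn_sliceMap hcont i j t) hti h₀ h₁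
      (hg₀ t) (hg₁ t) (hS t)
  · obtain ⟨i₀, e₀⟩ := integral_slice_term hσ₀ hσ₀1 hu hv hd₀ 1 φ
    obtain ⟨i₁, e₁⟩ := integral_slice_term hσ₁ hσ₁1 hu hv hd₁ 0 φ
    simp_rw [hS]
    refine ⟨i₀.sub i₁, ?_⟩
    rw [integral_sub i₀ i₁, e₀, e₁, hT]
    rfl
  · intro K hK hKG
    obtain ⟨C₀, h₀⟩ := abs_integral_partialDeriv_le (hut t) (hg₀ t) 1 hK hKG
    obtain ⟨C₁, h₁⟩ := abs_integral_partialDeriv_le (hut t) (hg₁ t) 0 hK hKG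
    refine ⟨C₀ + C₁, fun ψ hψ B hB => ?_⟩
    rw [hS, add_mul]
    exact (abs_sub _ _).trans (add_le_add (h₀ ψ hψ B hB) (h₁ ψ hψ B hB))

/-- If an entry of the adjugate is a measure, then almost every slice Jacobian is a measure, with
integrable total variation. -/
theorem exists_slice_measure {i : Fin 3} {T : 𝓓'(Ω, ℝ)}
    {S : ∀ t : ℝ, 𝓓'(sliceOpens Ω i t, ℝ)}
    (hS : ∀ φ : 𝓓(Ω, ℝ), Integrable (fun t : ℝ => S t (sliceTest i t φ)) ∧
      T φ = ∫ t : ℝ, S t (sliceTest i t φ))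
    (hord : ∀ t, IsOrderLEOne (S t)) (hT : IsFiniteRadon T) :
    ∃ δ : ℝ → SignedMeasure (Euc 2), (∀ᵐ t : ℝ, IsRepresentedBy (S t) (δ t)) ∧
      Integrable (fun t : ℝ => (δ t).variation.real (sliceOpens Ω i t : Set (Euc 2))) := by
  obtain ⟨ν, hν⟩ := hT
  obtain ⟨μ, σ, _, hσ, hσ1, h⟩ := exists_polar_decomposition ν
  have hrep := ae_eq_integral_sliceKernel (μ := μ) hσ hσ1 (S := S) (fun φ => ⟨(hS φ).1, by
    rw [← (hS φ).2, hν φ, h φ φ.continuous φ.hasCompactSupport]⟩) (ae_of_all _ hord)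
  have hg := integrable_slice_density (μ := μ) hσ hσ1 i
  refine ⟨fun t => (sliceKernel μ i t).withDensityᵥ
    fun y => sliceDensity μ i t * σ (kappa i t y), ?_, ?_⟩
  · filter_upwards [hrep] with t ht ψ
    rw [ht, integral_withDensityᵥ (hg t) ψ.continuous ψ.hasCompactSupport]
  · have hvar : ∀ t, ((sliceKernel μ i t).withDensityᵥ fun y =>
        sliceDensity μ i t * σ (kappa i t y)).variation.real (sliceOpens Ω i t : Set (Euc 2)) =
        sliceDensity μ i t * ∫ y, (Ω : Set (Euc 3)).indicator (fun x => |σ x|) (kappa i t y)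
          ∂sliceKernel μ i t := by
      intro t
      have hm := (sliceOpens Ω i t).isOpen.measurableSet
      rw [Measure.variation_withDensityᵥ (hg t), measureReal_def, withDensity_apply _ hm,
        ← integral_norm_eq_lintegral_enorm (hg t).aestronglyMeasurable.restrict,
        ← integral_indicator hm, ← integral_const_mul]
      refine integral_congr_ae (ae_of_all _ fun y => ?_)
      by_cases hy : kappa i t y ∈ (Ω : Set (Euc 3))
      · have hy' : y ∈ (sliceOpens Ω i t : Set (Euc 2)) := hy
        simp only [Set.indicator_of_mem hy, Set.indicator_of_mem hy', norm_mul, Real.norm_eq_abs,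
          abs_of_nonneg (sliceDensity_nonneg t)]
      · have hy' : y ∉ (sliceOpens Ω i t : Set (Euc 2)) := hy
        simp only [Set.indicator_of_notMem hy, Set.indicator_of_notMem hy', mul_zero]
    simp_rw [hvar]
    refine integrable_sliceDensity_mul (C := 1) (hσ.abs.indicator Ω.isOpen.measurableSet)
      fun x => ?_
    by_cases hx : x ∈ (Ω : Set (Euc 3))
    · simpa [Set.indicator_of_mem hx] using hσ1 x
    · simp [Set.indicator_of_notMem hx]

end Slices

end

theorem proposition4p3 (Ω : Opens (Euc 3)) (f : Euc 3 → Euc 3)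
    (hcont : ContinuousOn f (Ω : Set (Euc 3))) (hBV : MemBV Ω f) :
    -- both kinds of distributional adjugate exist and they are equal
    (∀ i j : Fin 3, (∃ T : 𝓓'(Ω, ℝ), IsAdjSecond Ω f i j T ∧ IsAdjFirst Ω f i j T) ∧
      ∀ T : 𝓓'(Ω, ℝ), IsAdjFirst Ω f i j T ↔ IsAdjSecond Ω f i j T) ∧
    -- if the entry `(i, j)` is a measure, then so is almost every slice Jacobian, and the total
    -- variation of the slice Jacobian is an integrable function of `t`
    (∀ (i j : Fin 3) (T : 𝓓'(Ω, ℝ)), IsAdjSecond Ω f i j T → IsFiniteRadon T →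
      ∃ (S : ∀ t : ℝ, 𝓓'(sliceOpens Ω i t, ℝ)) (δ : ℝ → SignedMeasure (Euc 2)),
        (∀ᵐ t : ℝ, IsSliceJacobian Ω f i j t (S t) ∧ IsRepresentedBy (S t) (δ t)) ∧
        Integrable (fun t : ℝ => (δ t).variation.real (sliceOpens Ω i t : Set (Euc 2)))) ∧
    -- within the class of measures all the definitions coincide
    (∀ T : Fin 3 → Fin 3 → 𝓓'(Ω, ℝ), (∀ i j, IsFiniteRadon (T i j)) →
      ((∀ i j, IsAdjSecond Ω f i j (T i j)) ↔ ∀ i j, IsAdjFirst Ω f i j (T i j)) ∧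
      ((∀ i j, IsAdjFirst Ω f i j (T i j)) ↔ IsSliceMeasureAdj Ω f T)) := by
  have hex := exists_adjugate hcont hBV
  have hiff : ∀ (i j : Fin 3) (T : 𝓓'(Ω, ℝ)), IsAdjFirst Ω f i j T ↔ IsAdjSecond Ω f i j T := by
    intro i j T
    obtain ⟨T₀, S, h₂, hJ, hS, -⟩ := hex i j
    have h₁ : IsAdjFirst Ω f i j T₀ := ⟨S, hJ, hS⟩
    exact ⟨fun h => h.unique h₁ ▸ h₂, fun h => h.unique h₂ ▸ h₁⟩
  have hmeas : ∀ (i j : Fin 3) (T : 𝓓'(Ω, ℝ)), IsAdjSecond Ω f i j T → IsFiniteRadon T →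
      ∃ (S : ∀ t : ℝ, 𝓓'(sliceOpens Ω i t, ℝ)) (δ : ℝ → SignedMeasure (Euc 2)),
        (∀ᵐ t : ℝ, IsSliceJacobian Ω f i j t (S t) ∧ IsRepresentedBy (S t) (δ t)) ∧
        Integrable (fun t : ℝ => (δ t).variation.real (sliceOpens Ω i t : Set (Euc 2))) := by
    intro i j T hT hR
    obtain ⟨T₀, S, h₂, hJ, hS, hord⟩ := hex i j
    obtain rfl := hT.unique h₂
    obtain ⟨δ, hδ, hδi⟩ := exists_slice_measure hS hord hR
    exact ⟨S, δ, hJ.and hδ, hδi⟩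
  refine ⟨fun i j => ⟨?_, hiff i j⟩, hmeas, fun T hR => ⟨?_, ?_⟩⟩
  · obtain ⟨T, S, h₂, -⟩ := hex i j
    exact ⟨T, h₂, (hiff i j T).2 h₂⟩
  · exact forall₂_congr fun i j => (hiff i j (T i j)).symm
  · refine ⟨fun h => ⟨h, fun i j => ?_⟩, fun h => h.1⟩
    obtain ⟨S, δ, hSδ, -⟩ := hmeas i j (T i j) ((hiff i j _).1 (h i j)) (hR i j)
    filter_upwards [hSδ] with t ht
    exact ⟨S t, ht.1, δ t, ht.2⟩
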